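/- Let $G$ be a finite connected chordal graph with vertex set $V$ and with $b$ blocks, where a block is a maximal connected subgraph without a cut vertex (bridges count as blocks, and a one-vertex graph has one block). In the simplicial shelling antimatroid of $G$, a set $F\subseteq V$ is feasible if its elements can be ordered $v_1,\dots,v_k$ so that, for each $i$, the neighbours of $v_i$ in $G-\{v_1,\dots,v_{i-1}\}$ form a clique; a set $C\subseteq V$ is convex if $V\setminus C$ is feasible. The convex closure $\overline{A}$ of $A \subseteq V$ is the smallest convex set containing $A$, and the interior vertices of a convex set $C$ are the $p\in C$ with $p\in\overline{C\setminus\{p\}}$. Let $\mathcal{S}$ be the family of all convex sets with exactly one interior vertex. Then (1) a set $C \subseteq V$ belongs to $\mathcal{S}$ if and only if $C$ is convex and the subgraph of $G$ induced by $C$ is a 1-sum of cliques, i.e. it is obtained from at least two disjoint cliques, each with at least two vertices, by gluing them together at one common vertex; (2) $$\sum_{S\in\mathcal{S}}(-1)^{|S|}=1-b.$$ -/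

import Mathlib

namespace ChordalShelling

variable {V : Type*}

/-- A graph is chordal if every cycle of length at least four has a chord, that is, an edge of the
graph which joins two vertices of the cycle but is not an edge of the cycle. -/
def IsChordal (G : SimpleGraph V) : Prop :=
  ∀ (u : V) (c : G.Walk u u), c.IsCycle → 4 ≤ c.length →
    ∃ x ∈ c.support, ∃ y ∈ c.support, G.Adj x y ∧ s(x, y) ∉ c.edges

/-! ### Blocks -/

/-- A subgraph is nonseparable if it is connected (in particular nonempty) and has no cut vertex:
deleting any one of its vertices leaves a graph in which any two vertices are joined by a path
(after deleting the vertex of a one-vertex graph this holds trivially). -/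
def IsNonseparable {G : SimpleGraph V} (H : G.Subgraph) : Prop :=
  H.Connected ∧ ∀ v ∈ H.verts, (H.deleteVerts {v}).Preconnected

/-- A block is a maximal nonseparable subgraph. -/
def IsBlock {G : SimpleGraph V} (H : G.Subgraph) : Prop :=
  Maximal IsNonseparable H

/-- The number of blocks. -/
noncomputable def numBlocks (G : SimpleGraph V) : ℕ :=
  {H : G.Subgraph | IsBlock H}.ncard

/-! ### The simplicial shelling antimatroid -/

/-- The vertex `v` is simplicial in the graph obtained from `G` by deleting the vertices in `D`:
its remaining neighbours form a clique. -/
def IsSimplicialAfter (G : SimpleGraph V) (D : Set V) (v : V) : Prop :=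
  v ∉ D ∧ G.IsClique (G.neighborSet v \ D)

/-- An ordered set of vertices is shellable if each of its vertices is simplicial in the graph
obtained by deleting the vertices listed before it. -/
def IsShellable (G : SimpleGraph V) (l : List V) : Prop :=
  ∀ (i : ℕ) (h : i < l.length), IsSimplicialAfter G {w | w ∈ l.take i} l[i]

/-- The feasible sets are the sets of vertices that have a shellable ordering. -/
def IsFeasible (G : SimpleGraph V) (F : Finset V) : Prop :=
  ∃ l : List V, IsShellable G l ∧ ∀ w, w ∈ F ↔ w ∈ l

variable [Fintype V] [DecidableEq V]

/-- The convex sets are the complements of the feasible sets. -/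
def IsConvex (G : SimpleGraph V) (C : Finset V) : Prop :=
  IsFeasible G Cᶜ

open Classical in
/-- The convex closure of `A`: the intersection of all convex sets containing `A`. -/
noncomputable def convexClosure (G : SimpleGraph V) (A : Finset V) : Finset V :=
  Finset.univ.filter fun x => ∀ D : Finset V, IsConvex G D → A ⊆ D → x ∈ D

/-- The extreme points of `C`: the points `p` of `C` outside the convex closure of `C - p`. -/
noncomputable def extremePoints (G : SimpleGraph V) (C : Finset V) : Finset V :=
  C.filter fun p => p ∉ convexClosure G (C.erase p)

/-- The interior of `C`: the points of `C` that are not extreme. -/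
noncomputable def interiorPoints (G : SimpleGraph V) (C : Finset V) : Finset V :=
  C \ extremePoints G C

open Classical in
/-- The family of all convex sets with exactly one interior vertex. -/
noncomputable def oneInteriorConvexSets (G : SimpleGraph V) : Finset (Finset V) :=
  Finset.univ.filter fun C => IsConvex G C ∧ (interiorPoints G C).card = 1

/-! ### 1-sums of cliques -/

/-- The subgraph induced by `C` is a 1-sum of cliques: it is the union of at least two cliques,
each with at least two vertices, which share one vertex `v` and are otherwise disjoint, and it has
no edges other than those of the cliques. -/
def IsOneSumOfCliques (G : SimpleGraph V) (C : Finset V) : Prop :=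
  ∃ (v : V) (K : Finset (Finset V)),
    2 ≤ K.card ∧
    (∀ A ∈ K, v ∈ A ∧ 2 ≤ A.card ∧ G.IsClique (A : Set V)) ∧
    (∀ A ∈ K, ∀ B ∈ K, A ≠ B → A ∩ B = {v}) ∧
    C = K.biUnion id ∧
    (∀ x ∈ C, ∀ y ∈ C, G.Adj x y → ∃ A ∈ K, x ∈ A ∧ y ∈ A)

end ChordalShelling

namespace ChordalShelling

variable {V : Type*} {G : SimpleGraph V}

/-! ### Simplicial vertices, shelling and connectivity of vertex sets -/

/-! A convex set is what remains after deleting simplicial vertices one at a time, and its extreme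
points are exactly its simplicial vertices (`notMem_convexClosure_erase_iff`). In a connected graph
convex sets are connected, so a unique interior vertex is adjacent to all the others, and the closed
neighbourhoods of the others are cliques meeting only in it. This gives (1).

For (2), the formula is proved for every connected vertex set `W` by induction, deleting a
simplicial vertex `s` (`oneInteriorSum_eq`). The sets avoiding `s` are those of `W \ s`. If `s` has
two neighbours, the sets containing `s` cancel in pairs by adding or removing a neighbour of `s`
other than the interior vertex, and the number of blocks does not change. If `s` has a single
neighbour `p`, the sets containing `s` are `D ∪ {s}` for the stars `D ≠ {p}` at `p`; the signed sum
of all stars at `p` in `W \ s` vanishes once `W \ s` has two vertices (`starSum_eq_zero`), so these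
sets contribute `-1`, matching the new block `{s, p}`.

The cancellations rest on `ShellsTo.insert_of_adj`: a deleted neighbour of a surviving simplicial
vertex of `W` can be put back. Chordality enters only through Dirac's theorem on simplicial
vertices. -/

/-- The neighbours of `v` in `W` form a clique. -/
def IsSimplicialIn (G : SimpleGraph V) (W : Finset V) (v : V) : Prop :=
  ∀ a ∈ W, ∀ b ∈ W, G.Adj v a → G.Adj v b → a ≠ b → G.Adj a b

theorem IsSimplicialIn.mono {W C : Finset V} {v : V} (h : IsSimplicialIn G W v) (hC : C ⊆ W) :
    IsSimplicialIn G C v :=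
  fun a ha b hb => h a (hC ha) b (hC hb)

/-- Any two vertices of `B` are joined by a path in `B`, stated through cuts. -/
def IsPreconnectedIn (G : SimpleGraph V) (B : Finset V) : Prop :=
  ∀ A ⊆ B, A.Nonempty → (∀ x ∈ A, ∀ y ∈ B, G.Adj x y → y ∈ A) → B ⊆ A

theorem isPreconnectedIn_of_isClique {B : Finset V} (h : G.IsClique (B : Set V)) :
    IsPreconnectedIn G B := by
  rintro A hA ⟨a, ha⟩ hcl y hy
  by_cases hay : a = y
  · exact hay ▸ ha
  · exact hcl a ha y hy (h (hA ha) hy hay)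

theorem IsPreconnectedIn.exists_adj {B : Finset V} {s t : V} (h : IsPreconnectedIn G B)
    (hs : s ∈ B) (ht : t ∈ B) (hst : s ≠ t) : ∃ b ∈ B, G.Adj s b := by
  by_contra! hno
  have := h {s} (by simpa) (by simp) (by simpa using fun y hy hsy => absurd hsy (hno y hy)) ht
  exact hst (Finset.mem_singleton.1 this).symm

variable [DecidableEq V]

/-- `C` is obtained from `W` by successively deleting simplicial vertices. -/
inductive ShellsTo (G : SimpleGraph V) (W : Finset V) : Finset V → Prop
  | refl : ShellsTo G W W
  | step {C : Finset V} {v : V} : ShellsTo G W C → v ∈ C → IsSimplicialIn G C v →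
      ShellsTo G W (C.erase v)

theorem ShellsTo.subset {W C : Finset V} (h : ShellsTo G W C) : C ⊆ W := by
  induction h with
  | refl => exact subset_rfl
  | step _ _ _ ih => exact (Finset.erase_subset _ _).trans ih

theorem ShellsTo.trans {W C D : Finset V} (h : ShellsTo G W C) (h' : ShellsTo G C D) :
    ShellsTo G W D := by
  induction h' with
  | refl => exact h
  | step _ hv hs ih => exact ih.step hv hs

/-- Simpliciality is hereditary, so `s` can be deleted first and the same deletions carried out
afterwards, omitting `s`. -/
theorem ShellsTo.erase_erase {W C : Finset V} {s : V} (h : ShellsTo G W C)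
    (hs : IsSimplicialIn G W s) : ShellsTo G (W.erase s) (C.erase s) := by
  induction h with
  | refl => exact .refl
  | @step C v hC hv hv' ih =>
    by_cases hvs : v = s
    · subst hvs; simpa using ih
    · rw [Finset.erase_right_comm]
      exact ih.step (Finset.mem_erase.2 ⟨hvs, hv⟩) (hv'.mono (Finset.erase_subset _ _))

/-- A vertex which has been deleted is simplicial with respect to what remains. -/
theorem ShellsTo.isSimplicialIn_of_notMem {W C : Finset V} {q : V} (h : ShellsTo G W C)
    (hq : q ∈ W) (hqC : q ∉ C) : IsSimplicialIn G C q := by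
  induction h with
  | refl => exact absurd hq hqC
  | @step C v hC hv hv' ih =>
    by_cases hvs : v = q
    · subst hvs; exact hv'.mono (Finset.erase_subset _ _)
    · exact (ih fun h => hqC (Finset.mem_erase.2 ⟨Ne.symm hvs, h⟩)).mono (Finset.erase_subset _ _)

/-- Put back `q`, a neighbour of a simplicial vertex `s`: the simplicial vertices of `C` remain
simplicial. -/
theorem IsSimplicialIn.insert_of_adj {W C : Finset V} {s q v : V} (hCW : C ⊆ W)
    (hs : IsSimplicialIn G W s) (hsC : s ∈ C) (hqW : q ∈ W) (hsq : G.Adj s q)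
    (hq : IsSimplicialIn G C q) (hvC : v ∈ C) (hv : IsSimplicialIn G C v) :
    IsSimplicialIn G (insert q C) v := by
  have key : ∀ y ∈ C, G.Adj v q → G.Adj v y → q ≠ y → G.Adj q y := by
    intro y hy hvq hvy hqy
    by_cases hsv : s = v
    · subst hsv; exact hs q hqW y (hCW hy) hvq hvy hqy
    -- Adjacency travels around: `q` simplicial gives `s ~ v`, then `v` simplicial gives `s ~ y`,
    -- and `s` simplicial in `W` gives `q ~ y`.
    have hvs : G.Adj s v := hq s hsC v hvC hsq.symm hvq.symm hsv
    by_cases hys : y = s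
    · subst hys; exact hsq.symm
    have : G.Adj s y := hv s hsC y hy hvs.symm hvy (Ne.symm hys)
    exact hs q hqW y (hCW hy) hsq this hqy
  intro a ha b hb hva hvb hab
  rcases Finset.mem_insert.1 ha with rfl | ha'
  · exact key b (Finset.mem_of_mem_insert_of_ne hb hab.symm) hva hvb hab
  · rcases Finset.mem_insert.1 hb with rfl | hb
    · exact (key a ha' hvb hva hab.symm).symm
    · exact hv a ha' b hb hva hvb hab

theorem IsSimplicialIn.insert_self {C : Finset V} {q : V} (h : IsSimplicialIn G C q) :
    IsSimplicialIn G (insert q C) q := by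
  intro a ha b hb hqa hqb hab
  refine h a ?_ b ?_ hqa hqb hab
  · exact Finset.mem_of_mem_insert_of_ne ha hqa.ne'
  · exact Finset.mem_of_mem_insert_of_ne hb hqb.ne'

/-- The same deletion order works with `q` omitted: once `q` is gone it is simplicial over what
remains, so putting it back spoils no later deletion. -/
theorem ShellsTo.insert_of_adj {W C : Finset V} {s q : V} (h : ShellsTo G W C)
    (hs : IsSimplicialIn G W s) (hsC : s ∈ C) (hqW : q ∈ W) (hsq : G.Adj s q) :
    ShellsTo G W (insert q C) := by
  induction h with
  | refl => rw [Finset.insert_eq_of_mem hqW]; exact .refl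
  | @step C v hC hv hv' ih =>
    have hsC' := Finset.mem_of_mem_erase hsC
    by_cases hvq : v = q
    · subst hvq; rw [Finset.insert_erase hv]; exact hC
    rw [← Finset.erase_insert_of_ne (Ne.symm hvq)]
    refine (ih hsC').step (Finset.mem_insert_of_mem hv) ?_
    by_cases hqC : q ∈ C
    · rwa [Finset.insert_eq_of_mem hqC]
    · exact hs.insert_of_adj hC.subset hsC' hqW hsq (hC.isSimplicialIn_of_notMem hqW hqC) hv hv'

/-- A path through `s` can be shortcut, since the neighbours of `s` are pairwise adjacent. In terms
of cuts: a closed set that touches `s` stays closed when `s` is added. -/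
theorem IsPreconnectedIn.erase {B : Finset V} {s : V} (h : IsPreconnectedIn G B)
    (hs : IsSimplicialIn G B s) : IsPreconnectedIn G (B.erase s) := by
  intro A hA hne hcl
  by_cases hsB : s ∈ B
  swap
  · rw [Finset.erase_eq_of_notMem hsB] at *; exact h A hA hne hcl
  have hAB := hA.trans (Finset.erase_subset _ _)
  by_cases hadj : ∃ a ∈ A, G.Adj s a
  · obtain ⟨a, ha, hsa⟩ := hadj
    have : B ⊆ insert s A := by
      refine h _ (Finset.insert_subset hsB hAB) (Finset.insert_nonempty _ _) ?_
      intro x hx y hy hxy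
      by_cases hys : y = s
      · simp [hys]
      refine Finset.mem_insert_of_mem ?_
      rcases Finset.mem_insert.1 hx with rfl | hx
      · by_cases hay : a = y
        · exact hay ▸ ha
        · exact hcl a ha y (Finset.mem_erase.2 ⟨hys, hy⟩) (hs a (hAB ha) y hy hsa hxy hay)
      · exact hcl x hx y (Finset.mem_erase.2 ⟨hys, hy⟩) hxy
    exact Finset.subset_insert_iff.1 this
  · push Not at hadj
    refine (Finset.erase_subset _ _).trans (h A hAB hne fun x hx y hy hxy => ?_)
    refine hcl x hx y (Finset.mem_erase.2 ⟨?_, hy⟩) hxy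
    rintro rfl
    exact hadj x hx hxy.symm

theorem IsPreconnectedIn.union {B D : Finset V} {x : V} (hB : IsPreconnectedIn G B)
    (hD : IsPreconnectedIn G D) (hxB : x ∈ B) (hxD : x ∈ D) : IsPreconnectedIn G (B ∪ D) := by
  intro A hA hne hcl
  have key : ∀ E ⊆ B ∪ D, IsPreconnectedIn G E → (∃ a ∈ A, a ∈ E) → E ⊆ A := by
    rintro E hE hpre ⟨a, ha, haE⟩
    refine (hpre (A ∩ E) Finset.inter_subset_right ⟨a, Finset.mem_inter.2 ⟨ha, haE⟩⟩ ?_).trans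
      Finset.inter_subset_left
    intro u hu v hv huv
    exact Finset.mem_inter.2 ⟨hcl u (Finset.mem_inter.1 hu).1 v (hE hv) huv, hv⟩
  have kB := key B Finset.subset_union_left hB
  have kD := key D Finset.subset_union_right hD
  obtain ⟨a, ha⟩ := hne
  have hx : x ∈ A := by
    rcases Finset.mem_union.1 (hA ha) with h | h
    · exact kB ⟨a, ha, h⟩ hxB
    · exact kD ⟨a, ha, h⟩ hxD
  exact Finset.union_subset (kB ⟨x, hx, hxB⟩) (kD ⟨x, hx, hxD⟩)

theorem IsPreconnectedIn.insert_of_adj {B : Finset V} {s b : V} (h : IsPreconnectedIn G B)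
    (hb : b ∈ B) (hsb : G.Adj s b) : IsPreconnectedIn G (insert s B) := by
  have h2 : IsPreconnectedIn G {s, b} :=
    isPreconnectedIn_of_isClique (by simpa [SimpleGraph.isClique_insert] using fun _ => hsb)
  have := h2.union h (x := b) (by simp) hb
  convert this using 1
  ext; simp; grind

theorem ShellsTo.isPreconnectedIn {W C : Finset V} (h : ShellsTo G W C)
    (hW : IsPreconnectedIn G W) : IsPreconnectedIn G C := by
  induction h with
  | refl => exact hW
  | step _ _ hs ih => exact ih.erase hs

/-- In a connected vertex set whose vertices other than `p` are simplicial, `p` is adjacent to all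
the others. -/
theorem IsPreconnectedIn.adj_of_forall_isSimplicialIn {C : Finset V} {p : V}
    (h : IsPreconnectedIn G C) (hp : p ∈ C) (hs : ∀ x ∈ C, x ≠ p → IsSimplicialIn G C x)
    {x : V} (hx : x ∈ C) (hxp : x ≠ p) : G.Adj p x := by
  classical
  have := h (C.filter fun y => y = p ∨ G.Adj p y) (Finset.filter_subset _ _) ⟨p, by simp [hp]⟩ ?_ hx
  · simpa [hxp] using (Finset.mem_filter.1 this).2
  · intro u hu v hv huv
    obtain ⟨huC, rfl | hpu⟩ := Finset.mem_filter.1 hu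
    · exact Finset.mem_filter.2 ⟨hv, .inr huv⟩
    · refine Finset.mem_filter.2 ⟨hv, ?_⟩
      by_cases hvp : v = p
      · exact .inl hvp
      · exact .inr (hs u huC hpu.ne' p hp v hv hpu.symm huv (Ne.symm hvp))

end ChordalShelling
namespace ChordalShelling

variable {V : Type*} [DecidableEq V] {G : SimpleGraph V}

/-! ### Alternating sums over stars -/

/-- `C` is obtained from `W` by shelling, and all its vertices other than `p` are simplicial. -/
def IsStar (G : SimpleGraph V) (W : Finset V) (p : V) (C : Finset V) : Prop :=
  ShellsTo G W C ∧ p ∈ C ∧ ∀ x ∈ C, x ≠ p → IsSimplicialIn G C x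

/-- Add `q` to `C` or remove it. -/
def toggle (q : V) (C : Finset V) : Finset V :=
  if q ∈ C then C.erase q else insert q C

theorem toggle_toggle (q : V) (C : Finset V) : toggle q (toggle q C) = C := by
  unfold toggle
  by_cases h : q ∈ C <;> simp [h]

theorem mem_toggle_of_ne {q x : V} (h : x ≠ q) {C : Finset V} : x ∈ toggle q C ↔ x ∈ C := by
  unfold toggle
  split_ifs <;> simp [h]

theorem toggle_ne (q : V) (C : Finset V) : toggle q C ≠ C := by
  unfold toggle
  split_ifs with h
  · exact fun e => by simpa [h] using congrArg (q ∈ ·) e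
  · exact fun e => by simpa [h] using congrArg (q ∈ ·) e

theorem neg_one_pow_card_toggle (q : V) (C : Finset V) :
    (-1 : ℤ) ^ C.card + (-1) ^ (toggle q C).card = 0 := by
  unfold toggle
  split_ifs with h
  · rw [← Finset.card_erase_add_one h, pow_succ]; ring
  · rw [Finset.card_insert_of_notMem h, pow_succ]; ring

/-- The toggled vertex may depend on `C`, but toggling must not change the choice; otherwise the map
is not an involution. -/
theorem sum_neg_one_pow_card_eq_zero_of_toggle (F : Finset (Finset V)) (q : Finset V → V)
    (hF : ∀ C ∈ F, toggle (q C) C ∈ F) (hq : ∀ C ∈ F, q (toggle (q C) C) = q C) :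
    ∑ C ∈ F, (-1 : ℤ) ^ C.card = 0 := by
  refine Finset.sum_involution (fun C _ => toggle (q C) C)
    (fun C _ => neg_one_pow_card_toggle _ _) (fun C _ _ => toggle_ne _ _) hF ?_
  intro C hC
  simp only [hq C hC, toggle_toggle]

theorem IsStar.erase {W C : Finset V} {p q : V} (h : IsStar G W p C) (hqC : q ∈ C) (hqp : q ≠ p) :
    IsStar G W p (C.erase q) :=
  ⟨h.1.step hqC (h.2.2 q hqC hqp), Finset.mem_erase.2 ⟨hqp.symm, h.2.1⟩, fun x hx hxp =>
    (h.2.2 x (Finset.mem_of_mem_erase hx) hxp).mono (Finset.erase_subset _ _)⟩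

theorem IsStar.insert {W C : Finset V} {p q s : V} (h : IsStar G W p C)
    (hs : IsSimplicialIn G W s) (hsC : s ∈ C) (hqW : q ∈ W) (hsq : G.Adj s q) (hqC : q ∉ C) :
    IsStar G W p (insert q C) := by
  have hq := h.1.isSimplicialIn_of_notMem hqW hqC
  refine ⟨h.1.insert_of_adj hs hsC hqW hsq, Finset.mem_insert_of_mem h.2.1, fun x hx hxp => ?_⟩
  rcases Finset.mem_insert.1 hx with rfl | hx
  · exact hq.insert_self
  · exact hs.insert_of_adj h.1.subset hsC hqW hsq hq hx (h.2.2 x hx hxp)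

theorem IsStar.toggle {W C : Finset V} {p q s : V} (h : IsStar G W p C)
    (hs : IsSimplicialIn G W s) (hsC : s ∈ C) (hqW : q ∈ W) (hsq : G.Adj s q) (hqp : q ≠ p) :
    IsStar G W p (toggle q C) := by
  unfold ChordalShelling.toggle
  split_ifs with hqC
  · exact h.erase hqC hqp
  · exact h.insert hs hsC hqW hsq hqC

/-- This is what lets the signed sums over `W` split into a sum over `W \ s` and the terms
containing `s`. -/
theorem shellsTo_erase_iff {W C : Finset V} {s : V} (hs : IsSimplicialIn G W s) (hsW : s ∈ W) :
    ShellsTo G (W.erase s) C ↔ ShellsTo G W C ∧ s ∉ C := by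
  constructor
  · intro h
    exact ⟨(ShellsTo.refl.step hsW hs).trans h, fun hsC => by simpa using h.subset hsC⟩
  · rintro ⟨h, hsC⟩
    simpa [Finset.erase_eq_of_notMem hsC] using h.erase_erase hs

theorem isStar_erase_iff {W C : Finset V} {s p : V} (hs : IsSimplicialIn G W s) (hsW : s ∈ W) :
    IsStar G (W.erase s) p C ↔ IsStar G W p C ∧ s ∉ C := by
  unfold IsStar
  rw [shellsTo_erase_iff hs hsW]
  tauto

/-- Add to `C` a vertex `s` whose only neighbour in `W` belongs to `C`. -/
theorem ShellsTo.insert_leaf {W C : Finset V} {s p : V} (h : ShellsTo G W C)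
    (hs : IsSimplicialIn G W s) (hsW : s ∈ W) (hN : ∀ y ∈ W, G.Adj s y → y = p) (hpC : p ∈ C) :
    ShellsTo G W (insert s C) := by
  induction h with
  | refl => rw [Finset.insert_eq_of_mem hsW]; exact .refl
  | @step C v hC hv hv' ih =>
    have ih := ih (Finset.mem_of_mem_erase hpC)
    by_cases hvs : v = s
    · subst hvs; rwa [Finset.insert_erase hv]
    rw [← Finset.erase_insert_of_ne (Ne.symm hvs)]
    have hvp : v ≠ p := by rintro rfl; simp at hpC
    have hvs' : ¬ G.Adj v s := fun h => hvp (hN v (hC.subset hv) h.symm)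
    refine ih.step (Finset.mem_insert_of_mem hv) fun a ha b hb hva hvb => ?_
    have hm : ∀ c ∈ insert s C, G.Adj v c → c ∈ C := fun c hc hvc =>
      Finset.mem_of_mem_insert_of_ne hc (by rintro rfl; exact hvs' hvc)
    exact hv' a (hm a ha hva) b (hm b hb hvb) hva hvb

theorem IsStar.insert_leaf {W C : Finset V} {s p : V} (h : IsStar G W p C)
    (hs : IsSimplicialIn G W s) (hsW : s ∈ W) (hN : ∀ y ∈ W, G.Adj s y → y = p) :
    IsStar G W p (Insert.insert s C) := by
  have hW := h.1.insert_leaf hs hsW hN h.2.1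
  refine ⟨hW, Finset.mem_insert_of_mem h.2.1, fun x hx hxp => ?_⟩
  by_cases hxs : x = s
  · subst hxs; exact hs.mono hW.subset
  replace hx := Finset.mem_of_mem_insert_of_ne hx hxs
  have hm : ∀ c ∈ Insert.insert s C, G.Adj x c → c ∈ C := fun c hc hxc =>
    Finset.mem_of_mem_insert_of_ne hc (by
      rintro rfl; exact hxp (hN x (h.1.subset hx) hxc.symm))
  exact fun a ha b hb hxa hxb => h.2.2 x hx hxp a (hm a ha hxa) b (hm b hb hxb) hxa hxb

/-- Every vertex set with at least two vertices has a simplicial vertex other than a given one. -/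
def HasSimplicialVertices (G : SimpleGraph V) : Prop :=
  ∀ (W : Finset V) (p : V), p ∈ W → 2 ≤ W.card → ∃ s ∈ W, s ≠ p ∧ IsSimplicialIn G W s

theorem HasSimplicialVertices.shellsTo_singleton (hG : HasSimplicialVertices G) (W : Finset V)
    (p : V) (hp : p ∈ W) : ShellsTo G W {p} := by
  induction hn : W.card generalizing W with
  | zero => simp_all
  | succ n ih =>
    by_cases h2 : 2 ≤ W.card
    · obtain ⟨s, hsW, hsp, hs⟩ := hG W p hp h2
      have := ih (W.erase s) (Finset.mem_erase.2 ⟨hsp.symm, hp⟩) (by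
        rw [Finset.card_erase_of_mem hsW]; omega)
      exact (ShellsTo.refl.step hsW hs).trans this
    · obtain ⟨a, rfl⟩ := Finset.card_eq_one.1 (show W.card = 1 by omega)
      rw [Finset.mem_singleton.1 hp]
      exact .refl

/-- `C` is obtained from `W` by shelling and has exactly one vertex which is not simplicial. -/
def HasOneInterior (G : SimpleGraph V) (W C : Finset V) : Prop :=
  ∃ p, IsStar G W p C ∧ ¬ IsSimplicialIn G C p

/-- Delete from a star with interior vertex `p` a neighbour `q ≠ p` of the simplicial vertex `s`. -/
theorem not_isSimplicialIn_erase {W C : Finset V} {p s q : V} (hC : C ⊆ W)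
    (hs : IsSimplicialIn G W s) (hsC : s ∈ C) (hps : G.Adj p s) (hsq : G.Adj s q)
    (hp : ¬ IsSimplicialIn G C p) : ¬ IsSimplicialIn G (C.erase q) p := by
  intro hp'
  refine hp ?_
  -- If `p` were simplicial in `C \ q`, all its neighbours other than `s` would be adjacent to `s`,
  -- hence to each other because `s` is simplicial.
  have key : ∀ a ∈ C, G.Adj p a → a ≠ s → G.Adj s a := by
    intro a ha hpa has
    by_cases haq : a = q
    · exact haq ▸ hsq
    · exact hp' s (Finset.mem_erase.2 ⟨hsq.ne, hsC⟩) a (Finset.mem_erase.2 ⟨haq, ha⟩) hps hpa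
        has.symm
  intro a ha b hb hpa hpb hab
  by_cases has : a = s
  · subst has; exact key b hb hpb hab.symm
  by_cases hbs : b = s
  · subst hbs; exact (key a ha hpa hab).symm
  exact hs a (hC ha) b (hC hb) (key a ha hpa has) (key b hb hpb hbs) hab

theorem HasOneInterior.adj {W C : Finset V} {s : V} (hW : IsPreconnectedIn G W)
    (hs : IsSimplicialIn G W s) (hsC : s ∈ C) {p : V} (hC : IsStar G W p C)
    (hp : ¬ IsSimplicialIn G C p) : G.Adj p s :=
  (hC.1.isPreconnectedIn hW).adj_of_forall_isSimplicialIn hC.2.1 hC.2.2 hsC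
    (by rintro rfl; exact hp (hs.mono hC.1.subset))

/-! ### Cancellation in the signed sums -/

variable [Fintype V]

open Classical in
/-- The alternating sum over all stars at `p`. -/
noncomputable def starSum (G : SimpleGraph V) (W : Finset V) (p : V) : ℤ :=
  ∑ C : Finset V with IsStar G W p C, (-1 : ℤ) ^ C.card

/-- Take a simplicial `s ≠ p`. If `s` has a neighbour `q ≠ p`, the stars containing `s` cancel by
toggling `q`, and those avoiding `s` are the stars of `W \ s`, covered by induction. Otherwise `s`
itself can be toggled in every star. -/
theorem starSum_eq_zero (hG : HasSimplicialVertices G) (W : Finset V) (p : V)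
    (hW : IsPreconnectedIn G W) (hp : p ∈ W) (hcard : 2 ≤ W.card) : starSum G W p = 0 := by
  classical
  induction hn : W.card using Nat.strong_induction_on generalizing W with
  | _ n ih =>
  obtain ⟨s, hsW, hsp, hs⟩ := hG W p hp hcard
  by_cases hq : ∃ q ∈ W, q ≠ p ∧ G.Adj s q
  · obtain ⟨q, hqW, hqp, hsq⟩ := hq
    have hcard' : 3 ≤ W.card := by
      have : ({p, s, q} : Finset V) ⊆ W := by simp [Finset.insert_subset_iff, *]
      simpa [Finset.card_insert_of_notMem, hsp.symm, hqp.symm, hsq.ne] using Finset.card_le_card this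
    have hc := Finset.card_erase_of_mem hsW
    have h1 : starSum G (W.erase s) p = 0 :=
      ih _ (by omega) _ (hW.erase hs) (Finset.mem_erase.2 ⟨hsp.symm, hp⟩) (by omega) rfl
    rw [starSum, ← Finset.sum_filter_add_sum_filter_not _ (s ∈ ·), Finset.filter_filter,
      Finset.filter_filter]
    have h2 : ∑ C : Finset V with IsStar G W p C ∧ s ∉ C, (-1 : ℤ) ^ C.card = 0 := by
      rw [← h1, starSum]
      simp only [isStar_erase_iff hs hsW]
    rw [h2, add_zero]
    refine sum_neg_one_pow_card_eq_zero_of_toggle _ (fun _ => q) ?_ (fun _ _ => rfl)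
    simp only [Finset.mem_filter, Finset.mem_univ, true_and]
    rintro C ⟨hC, hsC⟩
    exact ⟨hC.toggle hs hsC hqW hsq hqp, (mem_toggle_of_ne hsq.ne).2 hsC⟩
  · push Not at hq
    refine sum_neg_one_pow_card_eq_zero_of_toggle _ (fun _ => s) ?_ (fun _ _ => rfl)
    simp only [Finset.mem_filter, Finset.mem_univ, true_and]
    intro C hC
    unfold toggle
    split_ifs with hsC
    · exact hC.erase hsC hsp
    · exact hC.insert_leaf hs hsW fun y hy hsy => by_contra fun h => hq y hy h hsy

open Classical in
/-- The alternating sum over all sets with one interior vertex. -/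
noncomputable def oneInteriorSum (G : SimpleGraph V) (W : Finset V) : ℤ :=
  ∑ C : Finset V with HasOneInterior G W C, (-1 : ℤ) ^ C.card

open Classical in
theorem oneInteriorSum_eq_add {W : Finset V} {s : V} (hs : IsSimplicialIn G W s) (hsW : s ∈ W) :
    oneInteriorSum G W = oneInteriorSum G (W.erase s) +
      ∑ C : Finset V with HasOneInterior G W C ∧ s ∈ C, (-1 : ℤ) ^ C.card := by
  rw [oneInteriorSum, ← Finset.sum_filter_add_sum_filter_not _ (s ∈ ·), Finset.filter_filter,
      Finset.filter_filter, add_comm, oneInteriorSum]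
  congr! 3 with C
  simp only [HasOneInterior, isStar_erase_iff hs hsW]
  grind

/-- The sets containing `s` cancel: toggle `u`, unless `u` is the interior vertex, in which case
toggle `w`. The interior vertex survives the toggle, so the choice is stable. -/
theorem oneInteriorSum_erase_of_two_neighbors {W : Finset V} {s u w : V}
    (hW : IsPreconnectedIn G W) (hs : IsSimplicialIn G W s) (hsW : s ∈ W) (hu : u ∈ W) (hw : w ∈ W)
    (hsu : G.Adj s u) (hsw : G.Adj s w) (huw : u ≠ w) :
    oneInteriorSum G W = oneInteriorSum G (W.erase s) := by
  classical
  rw [oneInteriorSum_eq_add hs hsW, add_eq_left]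
  have key : ∀ (C : Finset V) (p q : V), IsStar G W p C → ¬ IsSimplicialIn G C p → s ∈ C →
      q ∈ W → G.Adj s q → q ≠ p →
      IsStar G W p (toggle q C) ∧ ¬ IsSimplicialIn G (toggle q C) p ∧ s ∈ toggle q C := by
    intro C p q hC hp hsC hqW hsq hqp
    refine ⟨hC.toggle hs hsC hqW hsq hqp, ?_, (mem_toggle_of_ne hsq.ne).2 hsC⟩
    unfold toggle
    split_ifs with hqC
    · exact not_isSimplicialIn_erase hC.1.subset hs hsC (HasOneInterior.adj hW hs hsC hC hp) hsq hp
    · exact fun h => hp (h.mono (Finset.subset_insert _ _))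
  -- Being the interior vertex is expressed through `C` alone, so that the toggled vertex is a
  -- function of `C`.
  have center : ∀ (C : Finset V) (p : V), IsStar G W p C → ¬ IsSimplicialIn G C p →
      ((u ∈ C ∧ ¬ IsSimplicialIn G C u) ↔ u = p) := by
    intro C p hC hp
    constructor
    · rintro ⟨h1, h2⟩
      exact by_contra fun h => h2 (hC.2.2 u h1 h)
    · rintro rfl
      exact ⟨hC.2.1, hp⟩
  have hq : ∀ (C : Finset V) (p : V), IsStar G W p C → ¬ IsSimplicialIn G C p →
      (if u ∈ C ∧ ¬ IsSimplicialIn G C u then w else u) = if u = p then w else u := by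
    intro C p hC hp
    simp only [center C p hC hp]
  have hprop : ∀ p, (if u = p then w else u) ∈ W ∧ G.Adj s (if u = p then w else u) ∧
      (if u = p then w else u) ≠ p := by
    intro p
    split_ifs with h
    · exact ⟨hw, hsw, h ▸ huw.symm⟩
    · exact ⟨hu, hsu, h⟩
  refine sum_neg_one_pow_card_eq_zero_of_toggle _
    (fun C => if u ∈ C ∧ ¬ IsSimplicialIn G C u then w else u) ?_ ?_
  · simp only [Finset.mem_filter, Finset.mem_univ, true_and]
    rintro C ⟨⟨p, hC, hp⟩, hsC⟩
    rw [hq C p hC hp]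
    obtain ⟨h1, h2, h3⟩ := hprop p
    obtain ⟨k1, k2, k3⟩ := key C p _ hC hp hsC h1 h2 h3
    exact ⟨⟨p, k1, k2⟩, k3⟩
  · simp only [Finset.mem_filter, Finset.mem_univ, true_and]
    rintro C ⟨⟨p, hC, hp⟩, hsC⟩
    rw [hq C p hC hp]
    obtain ⟨h1, h2, h3⟩ := hprop p
    obtain ⟨k1, k2, k3⟩ := key C p _ hC hp hsC h1 h2 h3
    exact hq _ p k1 k2

/-- A set containing `s` must have `p` as its interior vertex, the only neighbour of `s`. Deleting
`s` then leaves any star at `p` except `{p}`, with the sign reversed; the `+ 1` removes the term of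
`{p}`. -/
theorem oneInteriorSum_erase_of_leaf {W : Finset V} {s p : V}
    (hW : IsPreconnectedIn G W) (hs : IsSimplicialIn G W s) (hsW : s ∈ W) (hpW : p ∈ W)
    (hsp : G.Adj s p) (hN : ∀ y ∈ W, G.Adj s y → y = p) (hsing : ShellsTo G (W.erase s) {p}) :
    oneInteriorSum G W = oneInteriorSum G (W.erase s) - (starSum G (W.erase s) p + 1) := by
  classical
  have hstar : IsStar G (W.erase s) p {p} := ⟨hsing, by simp, by simp⟩
  have hmem : ({p} : Finset V) ∈ Finset.univ.filter fun C => IsStar G (W.erase s) p C := by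
    simpa using hstar
  rw [oneInteriorSum_eq_add hs hsW, starSum, ← Finset.sum_erase_add _ _ hmem, sub_eq_add_neg]
  simp only [Finset.card_singleton, pow_one, neg_add_cancel_right, ← Finset.sum_neg_distrib]
  congr 1
  refine Finset.sum_bij' (fun C _ => C.erase s) (fun C _ => insert s C) ?_ ?_ ?_ ?_ ?_
  · simp only [Finset.mem_filter, Finset.mem_univ, true_and, Finset.mem_erase]
    rintro C ⟨⟨c, hC, hc⟩, hsC⟩
    have hcs := HasOneInterior.adj hW hs hsC hC hc
    obtain rfl := hN c (hC.1.subset hC.2.1) hcs.symm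
    refine ⟨fun h => hc ?_, (isStar_erase_iff hs hsW).2 ⟨hC.erase hsC hsp.ne, by simp⟩⟩
    have : ∀ a ∈ C, a ≠ c → a = s := by
      intro a ha hac
      by_contra has
      have : a ∈ C.erase s := Finset.mem_erase.2 ⟨has, ha⟩
      rw [h] at this
      exact hac (by simpa using this)
    intro a ha b hb hca hcb hab
    exact absurd ((this a ha hca.ne').trans (this b hb hcb.ne').symm) hab
  · simp only [Finset.mem_filter, Finset.mem_univ, true_and, Finset.mem_erase]
    rintro D ⟨hDp, hD⟩
    have hD' := (isStar_erase_iff hs hsW).1 hD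
    refine ⟨⟨p, hD'.1.insert_leaf hs hsW hN, fun h => ?_⟩, by simp⟩
    -- Such a `y` and `s` are two nonadjacent neighbours of `p`, so `p` is interior in `D ∪ {s}`.
    obtain ⟨y, hy, hyp⟩ : ∃ y ∈ D, y ≠ p := by
      by_contra! hcon
      exact hDp (Finset.eq_singleton_iff_unique_mem.2 ⟨hD.2.1, hcon⟩)
    have hpy := (hD'.1.1.isPreconnectedIn hW).adj_of_forall_isSimplicialIn hD.2.1 hD.2.2 hy hyp
    have hys : s ≠ y := by rintro rfl; exact hD'.2 hy
    exact hyp (hN y (hD'.1.1.subset hy)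
      (h s (by simp) y (by simp [hy]) hsp.symm hpy hys))
  · simp only [Finset.mem_filter, Finset.mem_univ, true_and]
    rintro C ⟨_, hsC⟩
    exact Finset.insert_erase hsC
  · simp only [Finset.mem_filter, Finset.mem_univ, true_and, Finset.mem_erase]
    rintro D ⟨_, hD⟩
    exact Finset.erase_insert ((isStar_erase_iff hs hsW).1 hD).2
  · simp only [Finset.mem_filter, Finset.mem_univ, true_and]
    rintro C ⟨_, hsC⟩
    rw [← Finset.card_erase_add_one hsC, pow_succ]; ring

end ChordalShelling
namespace ChordalShelling

variable {V : Type*} {G : SimpleGraph V}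

/-! ### Simplicial vertices of chordal graphs -/

/-- The edges of `G` with both ends in `T`. -/
def restrictTo (G : SimpleGraph V) (T : Set V) : SimpleGraph V where
  Adj a b := G.Adj a b ∧ a ∈ T ∧ b ∈ T
  symm := ⟨fun _ _ h => ⟨h.1.symm, h.2.2, h.2.1⟩⟩
  loopless := ⟨fun _ h => h.1.ne rfl⟩

/-- Otherwise the edge would shortcut the stretch between the two vertices. -/
theorem adj_of_getVert_adj_of_length_eq_dist {H : SimpleGraph V} {x y : V} (w : H.Walk x y)
    (hw : w.length = H.dist x y) {i j : ℕ} (hij : i < j) (hj : j ≤ w.length)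
    (h : H.Adj (w.getVert i) (w.getVert j)) : j = i + 1 := by
  have := SimpleGraph.dist_le ((w.take i).append (SimpleGraph.Walk.cons h (w.drop j)))
  simp only [SimpleGraph.Walk.length_append, SimpleGraph.Walk.length_cons,
    SimpleGraph.Walk.take_length, SimpleGraph.Walk.drop_length] at this
  omega

theorem mem_of_mem_support_restrictTo {T : Set V} {x y a : V} (w : (restrictTo G T).Walk x y)
    (hx : x ∈ T) (ha : a ∈ w.support) : a ∈ T := by
  induction w with
  | nil => simp_all
  | cons h w ih =>
    rw [SimpleGraph.Walk.support_cons, List.mem_cons] at ha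
    rcases ha with rfl | ha
    · exact hx
    · exact ih h.2.2 ha

/-- In a chordal graph, two neighbours of `p` which are joined by a path avoiding all other
neighbours of `p` are adjacent. -/
theorem IsChordal.adj_of_reachable (hG : IsChordal G) {p y z : V} {T : Set V} (hpT : p ∉ T)
    (hT : ∀ t ∈ T, G.Adj p t → t = y ∨ t = z) (hpy : G.Adj p y) (hpz : G.Adj p z) (hyz : y ≠ z)
    (hyT : y ∈ T) (hr : (restrictTo G T).Reachable y z) : G.Adj y z := by
  by_contra hnadj
  -- A shortest path in `T`, closed up through `p`, is a cycle of length at least four when `y` and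
  -- `z` are not adjacent. It has no chord at `p`, whose neighbours in `T` are among `y` and `z`,
  -- and none between path vertices, by minimality.
  obtain ⟨w, hw, hlen⟩ := hr.exists_path_of_dist
  have hle : restrictTo G T ≤ G := fun a b h => h.1
  have hsupp : ∀ a ∈ w.support, a ∈ T := fun a ha => mem_of_mem_support_restrictTo w hyT ha
  have hz : z ∈ T := hsupp z w.end_mem_support
  have h2 : 2 ≤ w.length := by
    by_contra! hlt
    have h01 : w.length = 0 ∨ w.length = 1 := by omega
    rcases h01 with h | h
    · exact hyz (SimpleGraph.Walk.eq_of_length_eq_zero h)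
    · exact hnadj (hle (SimpleGraph.Walk.adj_of_length_eq_one h))
  set w' : G.Walk y z := w.mapLe hle with hw'
  have hsupp' : w'.support = w.support := by simp [hw']
  have hedges' : w'.edges = w.edges := by simp [hw']
  have hpw : p ∉ w'.support := fun h => hpT (hsupp p (hsupp' ▸ h))
  have hpath : (w'.concat hpz.symm).IsPath :=
    (SimpleGraph.Walk.concat_isPath_iff _).2 ⟨hw.mapLe hle, hpw⟩
  have hcyc : (SimpleGraph.Walk.cons hpy (w'.concat hpz.symm)).IsCycle := by
    refine (SimpleGraph.Walk.cons_isCycle_iff _ _).2 ⟨hpath, ?_⟩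
    rw [SimpleGraph.Walk.edges_concat]
    simp only [List.concat_eq_append, List.mem_append, List.mem_singleton, not_or]
    refine ⟨fun h => hpw (w'.fst_mem_support_of_mem_edges h), fun h => ?_⟩
    have := Sym2.eq_iff.1 h
    grind
  obtain ⟨a, ha, b, hb, hab, hne⟩ := hG p _ hcyc (by
    simp only [SimpleGraph.Walk.length_cons, SimpleGraph.Walk.length_concat]
    have : w'.length = w.length := by simp [hw']
    omega)
  have hmem : ∀ c ∈ (SimpleGraph.Walk.cons hpy (w'.concat hpz.symm)).support,
      c = p ∨ c ∈ w.support := by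
    intro c hc
    simp only [SimpleGraph.Walk.support_cons, SimpleGraph.Walk.support_concat, hsupp',
      List.mem_cons, List.mem_append] at hc
    grind
  have hedge : ∀ e, e ∈ (SimpleGraph.Walk.cons hpy (w'.concat hpz.symm)).edges ↔
      e = s(p, y) ∨ e ∈ w.edges ∨ e = s(z, p) := by
    intro e
    simp [SimpleGraph.Walk.edges_concat, hedges']
  rw [hedge] at hne
  push Not at hne
  have hp : ∀ c ∈ w.support, G.Adj p c → s(p, c) ≠ s(p, y) → s(p, c) ≠ s(z, p) → False := by
    intro c hc hpc h1 h2
    rcases hT c (hsupp c hc) hpc with rfl | rfl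
    · exact h1 rfl
    · exact h2 Sym2.eq_swap
  rcases hmem a ha with rfl | ha'
  · rcases hmem b hb with rfl | hb'
    · exact hab.ne rfl
    · exact hp b hb' hab hne.1 hne.2.2
  rcases hmem b hb with rfl | hb'
  · rw [Sym2.eq_swap] at hne
    exact hp a ha' hab.symm hne.1 hne.2.2
  obtain ⟨i, rfl, hi⟩ := SimpleGraph.Walk.mem_support_iff_exists_getVert.1 ha'
  obtain ⟨j, rfl, hj⟩ := SimpleGraph.Walk.mem_support_iff_exists_getVert.1 hb'
  have hH : (restrictTo G T).Adj (w.getVert i) (w.getVert j) := ⟨hab, hsupp _ ha', hsupp _ hb'⟩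
  have consec : ∀ k, k + 1 ≤ w.length → s(w.getVert k, w.getVert (k + 1)) ∈ w.edges := by
    intro k hk
    exact w.mk_mem_edges_iff_exists.2 ⟨k, hk, rfl⟩
  rcases lt_trichotomy i j with h | rfl | h
  · obtain rfl := adj_of_getVert_adj_of_length_eq_dist w hlen h hj hH
    exact hne.2.1 (consec i hj)
  · exact hab.ne rfl
  · obtain rfl := adj_of_getVert_adj_of_length_eq_dist w hlen h hi hH.symm
    exact hne.2.1 (Sym2.eq_swap ▸ consec j hi)

variable [DecidableEq V]

/-- In a chordal graph, if some vertex of `W` is neither `p` nor a neighbour of `p`, then such a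
vertex can be found which is simplicial in `W`. -/
theorem IsChordal.exists_isSimplicialIn_not_adj (hG : IsChordal G) (W : Finset V) (p x₀ : V)
    (hp : p ∈ W) (hx₀ : x₀ ∈ W) (hx₀p : x₀ ≠ p) (hpx₀ : ¬ G.Adj p x₀) :
    ∃ s ∈ W, s ≠ p ∧ ¬ G.Adj p s ∧ IsSimplicialIn G W s := by
  classical
  induction hn : W.card using Nat.strong_induction_on generalizing W p x₀ with
  | _ n ih =>
  set U : Set V := {x | x ∈ W ∧ x ≠ p ∧ ¬ G.Adj p x} with hU
  have hx₀U : x₀ ∈ U := ⟨hx₀, hx₀p, hpx₀⟩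
  -- `K` is the component of `x₀` after deleting `p` and its neighbours. Its boundary `S` lies in
  -- the neighbourhood of `p` and is a clique, because paths through `K` join any two of its
  -- vertices.
  set K : Finset V := W.filter fun y => (restrictTo G U).Reachable x₀ y with hK
  have hKU : ∀ k ∈ K, k ∈ U := by
    intro k hk
    obtain ⟨w⟩ := (Finset.mem_filter.1 hk).2
    exact mem_of_mem_support_restrictTo w hx₀U w.end_mem_support
  have hx₀K : x₀ ∈ K := Finset.mem_filter.2 ⟨hx₀, .rfl⟩
  set S : Finset V := W.filter fun y => y ∉ K ∧ ∃ k ∈ K, G.Adj k y with hS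
  have hpS : ∀ y ∈ S, G.Adj p y := by
    intro y hy
    obtain ⟨hyW, hyK, k, hk, hky⟩ := Finset.mem_filter.1 hy
    by_contra hpy
    by_cases hyp : y = p
    · subst hyp; exact (hKU k hk).2.2 hky.symm
    · refine hyK (Finset.mem_filter.2 ⟨hyW, (Finset.mem_filter.1 hk).2.trans ?_⟩)
      exact SimpleGraph.Adj.reachable ⟨hky, hKU k hk, hyW, hyp, hpy⟩
  have hScl : ∀ y ∈ S, ∀ z ∈ S, y ≠ z → G.Adj y z := by
    intro y hy z hz hyz
    obtain ⟨-, -, k, hk, hky⟩ := Finset.mem_filter.1 hy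
    obtain ⟨-, -, l, hl, hlz⟩ := Finset.mem_filter.1 hz
    set T : Set V := {t | t ∈ K ∨ t = y ∨ t = z} with hT
    have hreach : ∀ v, (restrictTo G U).Reachable x₀ v → (restrictTo G T).Reachable x₀ v := by
      intro v hv
      rw [SimpleGraph.reachable_iff_reflTransGen] at hv
      induction hv with
      | refl => exact .rfl
      | @tail b c hb hbc ih =>
        have hb' := (SimpleGraph.reachable_iff_reflTransGen _ _).2 hb
        refine ih.trans (SimpleGraph.Adj.reachable ⟨hbc.1, .inl ?_, .inl ?_⟩)
        · exact Finset.mem_filter.2 ⟨hbc.2.1.1, hb'⟩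
        · exact Finset.mem_filter.2 ⟨hbc.2.2.1, hb'.trans (SimpleGraph.Adj.reachable hbc)⟩
    refine hG.adj_of_reachable (p := p) (T := T) ?_ ?_ (hpS y hy) (hpS z hz) hyz (.inr (.inl rfl)) ?_
    · rintro (h | h | h)
      · exact (hKU p h).2.1 rfl
      · exact (hpS y hy).ne h
      · exact (hpS z hz).ne h
    · rintro t (h | h) hpt
      · exact absurd hpt (hKU t h).2.2
      · exact h
    · have h1 : (restrictTo G T).Reachable y k :=
        SimpleGraph.Adj.reachable ⟨hky.symm, .inr (.inl rfl), .inl hk⟩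
      have h2 : (restrictTo G T).Reachable l z :=
        SimpleGraph.Adj.reachable ⟨hlz, .inl hl, .inr (.inr rfl)⟩
      exact h1.trans (((hreach k (Finset.mem_filter.1 hk).2).symm.trans
        (hreach l (Finset.mem_filter.1 hl).2)).trans h2)
  have hKW : K ⊆ W := Finset.filter_subset _ _
  have hSW : S ⊆ W := Finset.filter_subset _ _
  have hpKS : p ∉ K ∪ S := by
    rw [Finset.mem_union]
    rintro (h | h)
    · exact (hKU p h).2.1 rfl
    · exact (hpS p h).ne rfl
  have hlt : (K ∪ S).card < n := by
    rw [← hn]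
    exact Finset.card_lt_card ⟨Finset.union_subset hKW hSW, fun h => hpKS (h hp)⟩
  -- A vertex of `K` has all its neighbours in `W` inside `K ∪ S`, so the search moves to this
  -- smaller set.
  suffices h : ∃ s ∈ K, IsSimplicialIn G (K ∪ S) s by
    obtain ⟨s, hs, hs'⟩ := h
    refine ⟨s, hKW hs, (hKU s hs).2.1, (hKU s hs).2.2, fun a ha b hb hsa hsb => ?_⟩
    have hmem : ∀ c ∈ W, G.Adj s c → c ∈ K ∪ S := by
      intro c hc hsc
      by_cases hcK : c ∈ K
      · exact Finset.mem_union_left _ hcK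
      · exact Finset.mem_union_right _ (Finset.mem_filter.2 ⟨hc, hcK, s, hs, hsc⟩)
    exact hs' a (hmem a ha hsa) b (hmem b hb hsb) hsa hsb
  -- The induction hypothesis is applied at a vertex having a non-neighbour in `K ∪ S`, preferably
  -- one of `S`. The simplicial vertex it gives cannot lie in `S`: `S` is a clique, and in the
  -- second case its vertices are adjacent to everything. With no such vertex, `K ∪ S` is a clique.
  by_cases h1 : ∃ q ∈ S, ∃ x ∈ K ∪ S, x ≠ q ∧ ¬ G.Adj q x
  · obtain ⟨q, hq, x, hx, hxq, hqx⟩ := h1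
    obtain ⟨s, hs, hsq, hqs, hs'⟩ := ih _ hlt (K ∪ S) q x (Finset.mem_union_right _ hq) hx hxq hqx rfl
    rcases Finset.mem_union.1 hs with h | h
    · exact ⟨s, h, hs'⟩
    · exact absurd (hScl q hq s h hsq.symm) hqs
  push Not at h1
  by_cases h2 : ∃ k ∈ K, ∃ x ∈ K ∪ S, x ≠ k ∧ ¬ G.Adj k x
  · obtain ⟨k, hk, x, hx, hxk, hkx⟩ := h2
    obtain ⟨s, hs, hsk, hks, hs'⟩ := ih _ hlt (K ∪ S) k x (Finset.mem_union_left _ hk) hx hxk hkx rfl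
    rcases Finset.mem_union.1 hs with h | h
    · exact ⟨s, h, hs'⟩
    · exact absurd (h1 s h k (Finset.mem_union_left _ hk) hsk.symm).symm hks
  push Not at h2
  refine ⟨x₀, hx₀K, fun a ha b hb _ _ hab => ?_⟩
  rcases Finset.mem_union.1 ha with h | h
  · exact h2 a h b hb hab.symm
  · exact h1 a h b hb hab.symm

/-- Every chordal graph has simplicial vertices, at least two in each vertex set with at least two
vertices. -/
theorem IsChordal.hasSimplicialVertices (hG : IsChordal G) : HasSimplicialVertices G := by
  intro W p hp hcard
  -- A simplicial vertex outside the closed neighbourhood of `k` differs from `p` as soon as `k` is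
  -- `p` or a neighbour of `p`. If no such `k` has a non-neighbour, `W` is a clique.
  by_cases h : ∃ k ∈ W, ∃ x ∈ W, x ≠ k ∧ ¬ G.Adj k x ∧ (k = p ∨ G.Adj k p)
  · obtain ⟨k, hk, x, hx, hxk, hkx, hkp⟩ := h
    obtain ⟨s, hs, hsk, hks, hs'⟩ := hG.exists_isSimplicialIn_not_adj W k x hk hx hxk hkx
    refine ⟨s, hs, ?_, hs'⟩
    rintro rfl
    rcases hkp with rfl | hkp
    · exact hsk rfl
    · exact hks hkp
  push Not at h
  obtain ⟨s, hs, hsp⟩ := Finset.exists_mem_ne (by omega : 1 < W.card) p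
  have hpa : ∀ a ∈ W, a ≠ p → G.Adj p a := by
    intro a ha hap
    by_contra hpa
    exact (h p hp a ha hap hpa).1 rfl
  refine ⟨s, hs, hsp, fun a ha b hb _ _ hab => ?_⟩
  by_contra hnab
  obtain ⟨hap, hnap⟩ := h a ha b hb hab.symm hnab
  exact hnap (hpa a ha hap).symm

end ChordalShelling
namespace ChordalShelling

variable {V : Type*} [DecidableEq V] {G : SimpleGraph V}

/-! ### Counting blocks -/

/-- The subgraph induced by `B` is connected and has no cut vertex. -/
def IsNonseparableIn (G : SimpleGraph V) (B : Finset V) : Prop :=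
  B.Nonempty ∧ IsPreconnectedIn G B ∧ ∀ v ∈ B, IsPreconnectedIn G (B.erase v)

theorem isNonseparableIn_of_isClique {B : Finset V} (hne : B.Nonempty)
    (h : G.IsClique (B : Set V)) : IsNonseparableIn G B :=
  ⟨hne, isPreconnectedIn_of_isClique h, fun v _ =>
    isPreconnectedIn_of_isClique (h.subset (by simp))⟩

theorem IsNonseparableIn.isPreconnectedIn_erase {B : Finset V} (h : IsNonseparableIn G B) (v : V) :
    IsPreconnectedIn G (B.erase v) := by
  by_cases hv : v ∈ B
  · exact h.2.2 v hv
  · rw [Finset.erase_eq_of_notMem hv]; exact h.2.1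

theorem IsNonseparableIn.erase {B : Finset V} {s : V} (h : IsNonseparableIn G B)
    (hs : IsSimplicialIn G B s) (hne : (B.erase s).Nonempty) : IsNonseparableIn G (B.erase s) := by
  refine ⟨hne, h.2.1.erase hs, fun v hv => ?_⟩
  rw [Finset.erase_right_comm]
  exact (h.2.2 v (Finset.mem_of_mem_erase hv)).erase (hs.mono (Finset.erase_subset _ _))

/-- After any deletion from `B`, one of the two attachment vertices remains. -/
theorem IsNonseparableIn.insert {B : Finset V} {s u w : V} (h : IsNonseparableIn G B)
    (hsB : s ∉ B) (hu : u ∈ B) (hw : w ∈ B) (huw : u ≠ w) (hsu : G.Adj s u) (hsw : G.Adj s w) :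
    IsNonseparableIn G (insert s B) := by
  refine ⟨Finset.insert_nonempty _ _, h.2.1.insert_of_adj hu hsu, fun v hv => ?_⟩
  rcases Finset.mem_insert.1 hv with rfl | hv
  · rw [Finset.erase_insert hsB]; exact h.2.1
  have hsv : s ≠ v := by rintro rfl; exact hsB hv
  rw [Finset.erase_insert_of_ne hsv]
  by_cases huv : u = v
  · exact (h.2.2 v hv).insert_of_adj (Finset.mem_erase.2 ⟨fun e => huw (huv.trans e.symm), hw⟩) hsw
  · exact (h.2.2 v hv).insert_of_adj (Finset.mem_erase.2 ⟨huv, hu⟩) hsu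

theorem IsNonseparableIn.union {B D : Finset V} {x y : V} (hB : IsNonseparableIn G B)
    (hD : IsNonseparableIn G D) (hxB : x ∈ B) (hxD : x ∈ D) (hyB : y ∈ B) (hyD : y ∈ D)
    (hxy : x ≠ y) : IsNonseparableIn G (B ∪ D) := by
  refine ⟨⟨x, by simp [hxB]⟩, hB.2.1.union hD.2.1 hxB hxD, fun v _ => ?_⟩
  rw [Finset.erase_union_distrib]
  by_cases hxv : x = v
  · have hyv : y ≠ v := fun e => hxy (hxv.trans e.symm)
    exact (hB.isPreconnectedIn_erase v).union (hD.isPreconnectedIn_erase v)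
      (Finset.mem_erase.2 ⟨hyv, hyB⟩) (Finset.mem_erase.2 ⟨hyv, hyD⟩)
  · exact (hB.isPreconnectedIn_erase v).union (hD.isPreconnectedIn_erase v)
      (Finset.mem_erase.2 ⟨hxv, hxB⟩) (Finset.mem_erase.2 ⟨hxv, hxD⟩)

/-- In a nonseparable set with at least three vertices, every vertex has two neighbours. -/
theorem IsNonseparableIn.exists_two_adj {B : Finset V} {s : V} (h : IsNonseparableIn G B)
    (hs : s ∈ B) (hcard : 3 ≤ B.card) :
    ∃ u ∈ B, ∃ w ∈ B, u ≠ w ∧ G.Adj s u ∧ G.Adj s w := by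
  obtain ⟨t, ht, hts⟩ := Finset.exists_mem_ne (by omega : 1 < B.card) s
  obtain ⟨u, hu, hsu⟩ := h.2.1.exists_adj hs ht hts.symm
  have hc := Finset.card_erase_of_mem hu
  have hsu' : s ∈ B.erase u := Finset.mem_erase.2 ⟨hsu.ne, hs⟩
  obtain ⟨r, hr, hrs⟩ := Finset.exists_mem_ne (by omega : 1 < (B.erase u).card) s
  obtain ⟨w, hw, hsw⟩ := (h.2.2 u hu).exists_adj hsu' hr hrs.symm
  exact ⟨u, hu, w, Finset.mem_of_mem_erase hw, (Finset.ne_of_mem_erase hw).symm, hsu, hsw⟩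

/-- The blocks of the subgraph induced by `W`, as vertex sets. -/
def IsBlockIn (G : SimpleGraph V) (W B : Finset V) : Prop :=
  Maximal (fun D => D ⊆ W ∧ IsNonseparableIn G D) B

theorem IsBlockIn.eq {W B D : Finset V} (h : IsBlockIn G W B) (hDW : D ⊆ W)
    (hD : IsNonseparableIn G D) (hBD : B ⊆ D) : B = D :=
  h.eq_of_le ⟨hDW, hD⟩ hBD

theorem isBlockIn_iff {W B : Finset V} : IsBlockIn G W B ↔ (B ⊆ W ∧ IsNonseparableIn G B) ∧
    ∀ D ⊆ W, IsNonseparableIn G D → B ⊆ D → D ⊆ B :=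
  ⟨fun h => ⟨h.1, fun _ hD hD' hBD => h.2 ⟨hD, hD'⟩ hBD⟩,
    fun h => ⟨h.1, fun _ hD hBD => h.2 _ hD.1 hD.2 hBD⟩⟩

theorem isNonseparableIn_pair {s p : V} (h : G.Adj s p) : IsNonseparableIn G {s, p} :=
  isNonseparableIn_of_isClique (by simp) (by simpa [SimpleGraph.isClique_insert] using fun _ => h)

theorem IsBlockIn.two_le_card {W B : Finset V} (h : IsBlockIn G W B) (hW : IsPreconnectedIn G W)
    (hcard : 2 ≤ W.card) : 2 ≤ B.card := by
  by_contra! hlt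
  have hpos := h.1.2.1.card_pos
  obtain ⟨a, rfl⟩ := Finset.card_eq_one.1 (show B.card = 1 by omega)
  have haW : a ∈ W := h.1.1 (by simp)
  obtain ⟨t, ht, hta⟩ := Finset.exists_mem_ne (by omega : 1 < W.card) a
  obtain ⟨b, hb, hab⟩ := hW.exists_adj haW ht hta.symm
  have := h.eq (D := {a, b}) (by simp [Finset.insert_subset_iff, haW, hb])
    (isNonseparableIn_pair hab) (by simp)
  have hb' : b ∈ ({a} : Finset V) := this ▸ by simp
  exact hab.ne (Finset.mem_singleton.1 hb').symm

theorem IsBlockIn.of_erase {W B : Finset V} {s : V} (h : IsBlockIn G W B) (hsB : s ∉ B) :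
    IsBlockIn G (W.erase s) B :=
  isBlockIn_iff.2 ⟨⟨Finset.subset_erase.2 ⟨h.1.1, hsB⟩, h.1.2⟩, fun _ hD hD' hBD =>
    (h.eq (hD.trans (Finset.erase_subset _ _)) hD' hBD).ge⟩

/-- The number of blocks of the subgraph induced by `W`. -/
noncomputable def numBlocksIn (G : SimpleGraph V) (W : Finset V) : ℕ :=
  {B | IsBlockIn G W B}.ncard

theorem numBlocksIn_singleton (a : V) : numBlocksIn G {a} = 1 := by
  rw [numBlocksIn, Set.ncard_eq_one]
  have hn : IsNonseparableIn G {a} := isNonseparableIn_of_isClique (by simp) (by simp)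
  refine ⟨{a}, Set.ext fun B => ?_⟩
  rw [Set.mem_ofPred_eq, Set.mem_singleton_iff, isBlockIn_iff]
  constructor
  · exact fun h => Finset.Subset.antisymm h.1.1 (h.2 _ subset_rfl hn h.1.1)
  · rintro rfl
    exact ⟨⟨subset_rfl, hn⟩, fun D hD _ _ => hD⟩

theorem numBlocksIn_pair {s p : V} (h : G.Adj s p) : numBlocksIn G {s, p} = 1 := by
  rw [numBlocksIn, Set.ncard_eq_one]
  have hn := isNonseparableIn_pair h
  refine ⟨{s, p}, Set.ext fun B => ?_⟩
  rw [Set.mem_ofPred_eq, Set.mem_singleton_iff, isBlockIn_iff]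
  constructor
  · exact fun h => Finset.Subset.antisymm h.1.1 (h.2 _ subset_rfl hn h.1.1)
  · rintro rfl
    exact ⟨⟨subset_rfl, hn⟩, fun D hD _ _ => hD⟩

theorem finite_setOf_isBlockIn (W : Finset V) : {B | IsBlockIn G W B}.Finite :=
  (Finset.finite_toSet W.powerset).subset fun _ hB => by simpa using hB.1.1

/-- A nonseparable set containing the leaf `s` has at most two vertices, so the only new block is
`{s, p}`. With at least three vertices in `W`, no old block is a single vertex that `{s, p}` could
absorb. -/
theorem numBlocksIn_of_leaf {W : Finset V} {s p : V} (hW : IsPreconnectedIn G W)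
    (hs : IsSimplicialIn G W s) (hsW : s ∈ W) (hpW : p ∈ W) (hsp : G.Adj s p)
    (hN : ∀ y ∈ W, G.Adj s y → y = p) (hcard : 3 ≤ W.card) :
    numBlocksIn G W = numBlocksIn G (W.erase s) + 1 := by
  have hc := Finset.card_erase_of_mem hsW
  have hle : ∀ D ⊆ W, IsNonseparableIn G D → s ∈ D → D.card ≤ 2 := by
    intro D hDW hD hsD
    by_contra! hlt
    obtain ⟨u, hu, w, hw, huw, hsu, hsw⟩ := hD.exists_two_adj hsD hlt
    exact huw ((hN u (hDW hu) hsu).trans (hN w (hDW hw) hsw).symm)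
  have hpair : ({s, p} : Finset V) ⊆ W := by simp [Finset.insert_subset_iff, hsW, hpW]
  have hpc : ({s, p} : Finset V).card = 2 := Finset.card_pair hsp.ne
  have hnot : ({s, p} : Finset V) ∉ {B | IsBlockIn G (W.erase s) B} := fun h => by
    simpa using h.1.1 (show s ∈ ({s, p} : Finset V) by simp)
  have : {B | IsBlockIn G W B} = insert {s, p} {B | IsBlockIn G (W.erase s) B} := by
    ext B
    simp only [Set.mem_insert_iff, Set.mem_ofPred_eq]
    constructor
    · intro hB
      by_cases hsB : s ∈ B
      · left
        have h2 := hB.two_le_card hW (by omega)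
        obtain ⟨t, ht, hts⟩ := Finset.exists_mem_ne (by omega : 1 < B.card) s
        obtain ⟨b, hb, hsb⟩ := hB.1.2.2.1.exists_adj hsB ht hts.symm
        obtain rfl := hN b (hB.1.1 hb) hsb
        refine (Finset.eq_of_subset_of_card_le ?_ ?_).symm
        · simp [Finset.insert_subset_iff, hsB, hb]
        · rw [hpc]; exact hle B hB.1.1 hB.1.2 hsB
      · exact .inr (hB.of_erase hsB)
    · rintro (rfl | hB)
      · refine isBlockIn_iff.2 ⟨⟨hpair, isNonseparableIn_pair hsp⟩, fun D hD hD' hBD => ?_⟩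
        refine (Finset.eq_of_subset_of_card_le hBD ?_).ge
        rw [hpc]; exact hle D hD hD' (hBD (by simp))
      · refine isBlockIn_iff.2 ⟨⟨hB.1.1.trans (Finset.erase_subset _ _), hB.1.2⟩,
          fun D hD hD' hBD => ?_⟩
        by_cases hsD : s ∈ D
        · have h2 := hB.two_le_card (hW.erase hs) (by omega)
          have hsB : s ∉ B := fun h => by simpa using hB.1.1 h
          have := Finset.card_lt_card (Finset.ssubset_iff_subset_ne.2
            ⟨hBD, fun e => hsB (e ▸ hsD)⟩)
          have := hle D hD hD' hsD
          omega
        · exact (hB.eq (Finset.subset_erase.2 ⟨hD, hsD⟩) hD' hBD).ge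
  rw [numBlocksIn, this, Set.ncard_insert_of_notMem hnot (finite_setOf_isBlockIn _), numBlocksIn]

/-- Deleting `s` from each block is a bijection onto the blocks of `W \ s`. A block containing `s`
contains `u` and `w` by maximality, and so `s` can be reattached to any nonseparable set extending
what is left. -/
theorem numBlocksIn_of_two_neighbors {W : Finset V} {s u w : V} (hW : IsPreconnectedIn G W)
    (hs : IsSimplicialIn G W s) (hsW : s ∈ W) (hu : u ∈ W) (hw : w ∈ W) (huw : u ≠ w)
    (hsu : G.Adj s u) (hsw : G.Adj s w) :
    numBlocksIn G W = numBlocksIn G (W.erase s) := by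
  have hcard : 3 ≤ W.card := by
    have : ({s, u, w} : Finset V) ⊆ W := by simp [Finset.insert_subset_iff, *]
    simpa [Finset.card_insert_of_notMem, huw, hsu.ne, hsw.ne] using Finset.card_le_card this
  have hc := Finset.card_erase_of_mem hsW
  have huwadj : G.Adj u w := hs u hu w hw hsu hsw huw
  have htri : IsNonseparableIn G {s, u, w} := by
    refine isNonseparableIn_of_isClique (by simp) ?_
    simp [SimpleGraph.isClique_insert, hsu, hsw, huwadj]
  -- a nonseparable set meeting the neighbourhood of `s` twice can be joined with the triangle
  have hjoin : ∀ D ⊆ W, IsNonseparableIn G D → ∀ a ∈ D, ∀ b ∈ D, a ≠ b → G.Adj s a → G.Adj s b →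
      IsNonseparableIn G (insert u (insert w D)) := by
    intro D hDW hD a ha b hb hab hsa hsb
    have one : ∀ (E : Finset V) (t : V), E ⊆ W → t ∈ W → G.Adj s t → IsNonseparableIn G E →
        a ∈ E → b ∈ E → IsNonseparableIn G (insert t E) := by
      intro E t hEW htW hst hE haE hbE
      by_cases htE : t ∈ E
      · rwa [Finset.insert_eq_of_mem htE]
      · have hta : t ≠ a := by rintro rfl; exact htE haE
        have htb : t ≠ b := by rintro rfl; exact htE hbE
        exact hE.insert htE haE hbE hab (hs t htW a (hEW haE) hst hsa hta)
          (hs t htW b (hEW hbE) hst hsb htb)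
    exact one _ u (Finset.insert_subset hw hDW) hu hsu (one D w hDW hw hsw hD ha hb)
      (by simp [ha]) (by simp [hb])
  have hbig : ∀ B, IsBlockIn G W B → s ∈ B → 3 ≤ B.card := by
    intro B hB hsB
    by_contra! hlt
    have h2 := hB.two_le_card hW (by omega)
    obtain ⟨t, ht, hts⟩ := Finset.exists_mem_ne (by omega : 1 < B.card) s
    obtain ⟨b, hb, hsb⟩ := hB.1.2.2.1.exists_adj hsB ht hts.symm
    have hpair : ({s, b} : Finset V) = B := Finset.eq_of_subset_of_card_le
      (by simp [Finset.insert_subset_iff, hsB, hb]) (by rw [Finset.card_pair hsb.ne]; omega)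
    have hbW := hB.1.1 hb
    obtain ⟨c, hcW, hsc, hcb⟩ : ∃ c ∈ W, G.Adj s c ∧ c ≠ b := by
      by_cases h : u = b
      · exact ⟨w, hw, hsw, fun e => huw (h.trans e.symm)⟩
      · exact ⟨u, hu, hsu, h⟩
    have hcl : IsNonseparableIn G (insert c B) := by
      rw [← hpair]
      refine isNonseparableIn_of_isClique (by simp) ?_
      simp [SimpleGraph.isClique_insert, hsb, hsc.symm, hs c hcW b hbW hsc hsb hcb]
    have := hB.eq (Finset.insert_subset hcW hB.1.1) hcl (Finset.subset_insert _ _)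
    have hcB : c ∈ B := this ▸ Finset.mem_insert_self _ _
    rw [← hpair] at hcB
    simp [hsc.ne', hcb] at hcB
  have huwB : ∀ B, IsBlockIn G W B → s ∈ B → u ∈ B ∧ w ∈ B := by
    intro B hB hsB
    obtain ⟨a, ha, b, hb, hab, hsa, hsb⟩ := hB.1.2.exists_two_adj hsB (hbig B hB hsB)
    have := hB.eq (D := insert u (insert w B))
      (Finset.insert_subset hu (Finset.insert_subset hw hB.1.1))
      (hjoin B hB.1.1 hB.1.2 a ha b hb hab hsa hsb)
      ((Finset.subset_insert _ _).trans (Finset.subset_insert _ _))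
    rw [this]
    simp
  refine Set.ncard_congr (fun B _ => B.erase s) ?_ ?_ ?_
  · intro B hB
    by_cases hsB : s ∈ B
    swap
    · rw [Finset.erase_eq_of_notMem hsB]; exact hB.of_erase hsB
    obtain ⟨huB, hwB⟩ := huwB B hB hsB
    have huB' : u ∈ B.erase s := Finset.mem_erase.2 ⟨hsu.ne', huB⟩
    have hwB' : w ∈ B.erase s := Finset.mem_erase.2 ⟨hsw.ne', hwB⟩
    refine isBlockIn_iff.2 ⟨⟨Finset.erase_subset_erase _ hB.1.1,
      hB.1.2.erase (hs.mono hB.1.1) ⟨u, huB'⟩⟩, fun D hD hD' hBD => ?_⟩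
    have hsD : s ∉ D := fun h => by simpa using hD h
    have := hB.eq (D := insert s D)
      (Finset.insert_subset hsW (hD.trans (Finset.erase_subset _ _)))
      (hD'.insert hsD (hBD huB') (hBD hwB') huw hsu hsw) (Finset.subset_insert_iff.2 hBD)
    rw [this, Finset.erase_insert hsD]
  · intro B D hB hD hBD
    have key : ∀ B D : Finset V, IsBlockIn G W B → IsBlockIn G W D → B.erase s = D.erase s →
        s ∉ B → B = D := by
      intro B D hB hD hBD hsB
      rw [Finset.erase_eq_of_notMem hsB] at hBD
      exact hB.eq hD.1.1 hD.1.2 (hBD ▸ Finset.erase_subset _ _)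
    by_cases hsB : s ∈ B
    · by_cases hsD : s ∈ D
      · rw [← Finset.insert_erase hsB, hBD, Finset.insert_erase hsD]
      · exact (key D B hD hB hBD.symm hsD).symm
    · exact key B D hB hD hBD hsB
  · intro B hB
    have hsB : s ∉ B := fun h => by simpa using hB.1.1 h
    have hBW : B ⊆ W := hB.1.1.trans (Finset.erase_subset _ _)
    have herase : ∀ D ⊆ W, IsNonseparableIn G D → B ⊆ D → D.erase s = B := by
      intro D hD hD' hBD
      have hB' : B ⊆ D.erase s := Finset.subset_erase.2 ⟨hBD, hsB⟩
      by_cases hsD : s ∈ D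
      · exact (hB.eq (Finset.erase_subset_erase _ hD)
          (hD'.erase (hs.mono hD) (hB.1.2.1.mono hB')) hB').symm
      · rw [Finset.erase_eq_of_notMem hsD] at *
        exact (hB.eq (Finset.subset_erase.2 ⟨hD, hsD⟩) hD' hB').symm
    -- Every nonseparable extension of `B` in `W` adds at most `s`; the preimage of `B` is the
    -- extension containing `s` if there is one, and `B` itself otherwise.
    by_cases hext : ∃ D ⊆ W, IsNonseparableIn G D ∧ B ⊆ D ∧ s ∈ D
    · obtain ⟨D, hDW, hD, hBD, hsD⟩ := hext
      have hDB := herase D hDW hD hBD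
      refine ⟨D, isBlockIn_iff.2 ⟨⟨hDW, hD⟩, fun E hE hE' hDE => ?_⟩, hDB⟩
      rw [← Finset.insert_erase hsD, hDB, ← herase E hE hE' (hBD.trans hDE),
        Finset.insert_erase (hDE hsD)]
    · push Not at hext
      refine ⟨B, isBlockIn_iff.2 ⟨⟨hBW, hB.1.2⟩, fun E hE hE' hBE => ?_⟩,
        Finset.erase_eq_of_notMem hsB⟩
      have := herase E hE hE' hBE
      rw [Finset.erase_eq_of_notMem (hext E hE hE' hBE)] at this
      exact this.le

/-! ### The signed sum in terms of the number of blocks -/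

theorem oneInteriorSum_singleton [Fintype V] (a : V) : oneInteriorSum G {a} = 0 := by
  classical
  refine Finset.sum_eq_zero fun C hC => ?_
  obtain ⟨p, hC, hp⟩ := (Finset.mem_filter.1 hC).2
  refine absurd (fun x hx y hy _ _ hxy => absurd ?_ hxy) hp
  rw [Finset.mem_singleton.1 (hC.1.subset hx), Finset.mem_singleton.1 (hC.1.subset hy)]

theorem oneInteriorSum_eq [Fintype V] (hG : HasSimplicialVertices G) (W : Finset V)
    (hne : W.Nonempty) (hW : IsPreconnectedIn G W) :
    oneInteriorSum G W = 1 - (numBlocksIn G W : ℤ) := by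
  induction hn : W.card using Nat.strong_induction_on generalizing W with
  | _ n ih =>
  obtain ⟨p₀, hp₀⟩ := hne
  by_cases h2 : 2 ≤ W.card
  swap
  · have := Finset.card_pos.2 ⟨p₀, hp₀⟩
    obtain ⟨a, rfl⟩ := Finset.card_eq_one.1 (show W.card = 1 by omega)
    rw [oneInteriorSum_singleton, numBlocksIn_singleton]; simp
  obtain ⟨s, hsW, hsp₀, hs⟩ := hG W p₀ hp₀ h2
  have hc := Finset.card_erase_of_mem hsW
  have hpre := hW.erase hs
  have hIH := ih _ (by omega) (W.erase s) ⟨p₀, Finset.mem_erase.2 ⟨hsp₀.symm, hp₀⟩⟩ hpre rfl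
  obtain ⟨p, hpW, hsp⟩ := hW.exists_adj hsW hp₀ hsp₀
  by_cases hN : ∀ y ∈ W, G.Adj s y → y = p
  · have hp' : p ∈ W.erase s := Finset.mem_erase.2 ⟨hsp.ne', hpW⟩
    rw [oneInteriorSum_erase_of_leaf hW hs hsW hpW hsp hN (hG.shellsTo_singleton _ _ hp')]
    by_cases h3 : 3 ≤ W.card
    · rw [hIH, starSum_eq_zero hG _ p hpre hp' (by omega),
        numBlocksIn_of_leaf hW hs hsW hpW hsp hN h3]
      push_cast; ring
    · have hWp : W.erase s = {p} := by
        refine (Finset.eq_of_subset_of_card_le (by simpa using hp') ?_).symm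
        simp; omega
      have hWsp : W = {s, p} := by rw [← Finset.insert_erase hsW, hWp]
      rw [hWp, oneInteriorSum_singleton, hWsp, numBlocksIn_pair hsp]
      -- Here the correction `starSum + 1` is zero, as it must be: passing from one vertex to one
      -- edge leaves a single block.
      have : starSum G {p} p = -1 := by
        classical
        rw [starSum, Finset.sum_eq_single {p}]
        · simp
        · intro C hC hCp
          have hC := (Finset.mem_filter.1 hC).2
          exact absurd (Finset.Subset.antisymm hC.1.subset (by simpa using hC.2.1)) hCp
        · intro h
          exact absurd (Finset.mem_filter.2 ⟨Finset.mem_univ _, .refl, by simp, by simp⟩) h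
      rw [this]; simp
  · push Not at hN
    obtain ⟨q, hqW, hsq, hqp⟩ := hN
    rw [oneInteriorSum_erase_of_two_neighbors hW hs hsW hqW hpW hsq hsp hqp, hIH,
      numBlocksIn_of_two_neighbors hW hs hsW hqW hpW hqp hsq hsp]

end ChordalShelling
namespace ChordalShelling

variable {V : Type*} {G : SimpleGraph V}

/-! ### Comparison with subgraphs -/

theorem preconnected_iff_forall_closed {H : SimpleGraph V} :
    H.Preconnected ↔ ∀ A : Set V, A.Nonempty → (∀ x ∈ A, ∀ y, H.Adj x y → y ∈ A) →
      ∀ y, y ∈ A := by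
  constructor
  · rintro h A ⟨x, hx⟩ hcl y
    obtain ⟨w⟩ := h x y
    induction w with
    | nil => exact hx
    | cons hadj _ ih => exact ih (hcl _ hx _ hadj)
  · intro h x y
    exact h {z | H.Reachable x z} ⟨x, SimpleGraph.Reachable.rfl⟩
      (fun z hz z' hadj => SimpleGraph.Reachable.trans hz hadj.reachable) y

theorem isPreconnectedIn_of_subgraph {H : G.Subgraph} {B : Finset V} (hB : H.verts = B)
    (h : H.Preconnected) : IsPreconnectedIn G B := by
  rintro A hA ⟨a, ha⟩ hcl y hy
  have hmem : ∀ z, z ∈ B → z ∈ H.verts := fun z hz => by rw [hB]; exact hz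
  exact preconnected_iff_forall_closed.1 h.coe {z | (z : V) ∈ A} ⟨⟨a, hmem a (hA ha)⟩, ha⟩
    (fun x hx z hxz => hcl x hx z (hB.subset z.2) hxz.adj_sub)
    ⟨y, hmem y hy⟩

theorem IsPreconnectedIn.subgraph_preconnected {H : G.Subgraph} {B : Finset V} (hB : H.verts = B)
    (hH : ∀ x ∈ B, ∀ y ∈ B, G.Adj x y → H.Adj x y) (h : IsPreconnectedIn G B) :
    H.Preconnected := by
  classical
  refine ⟨preconnected_iff_forall_closed.2 ?_⟩
  rintro A ⟨a, ha⟩ hcl y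
  have hmem : ∀ z, z ∈ H.verts ↔ z ∈ B := fun z => by rw [hB]; rfl
  have := h (B.filter fun z => ∃ hz : z ∈ H.verts, ⟨z, hz⟩ ∈ A) (Finset.filter_subset _ _)
    ⟨a, Finset.mem_filter.2 ⟨(hmem a).1 a.2, a.2, ha⟩⟩ ?_ ((hmem y).1 y.2)
  · exact (Finset.mem_filter.1 this).2.2
  · intro x hx z hz hxz
    obtain ⟨hxB, hxH, hxA⟩ := Finset.mem_filter.1 hx
    exact Finset.mem_filter.2 ⟨hz, (hmem z).2 hz, hcl _ hxA ⟨z, (hmem z).2 hz⟩ (hH x hxB z hz hxz)⟩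

theorem isPreconnectedIn_univ [Fintype V] (h : G.Preconnected) : IsPreconnectedIn G Finset.univ := by
  intro A _ hne hcl y _
  exact preconnected_iff_forall_closed.1 h A hne
    (fun x hx z hxz => hcl x hx z (Finset.mem_univ z) hxz) y

/-! ### Shelling orders as lists -/

theorem isSimplicialAfter_iff {C : Finset V} {D : Set V} (hCD : ∀ w, w ∈ C ↔ w ∉ D) {v : V} :
    IsSimplicialAfter G D v ↔ v ∈ C ∧ IsSimplicialIn G C v := by
  refine and_congr (hCD v).symm ⟨fun h a ha b hb hva hvb hab => ?_, fun h a ha b hb hab => ?_⟩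
  · exact h ⟨hva, (hCD a).1 ha⟩ ⟨hvb, (hCD b).1 hb⟩ hab
  · exact h a ((hCD a).2 ha.2) b ((hCD b).2 hb.2) ha.1 hb.1 hab

theorem isShellable_append_singleton {l : List V} {v : V} :
    IsShellable G (l ++ [v]) ↔ IsShellable G l ∧ IsSimplicialAfter G {w | w ∈ l} v := by
  constructor
  · intro h
    constructor
    · intro i hi
      have := h i (by simp; omega)
      rwa [List.take_append_of_le_length hi.le, List.getElem_append_left hi] at this
    · have := h l.length (by simp)
      simpa using this
  · rintro ⟨h, hv⟩ i hi
    rcases lt_or_ge i l.length with hlt | hge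
    · have := h i hlt
      rwa [List.take_append_of_le_length hlt.le, List.getElem_append_left hlt]
    · obtain rfl : i = l.length := by simp at hi; omega
      simpa using hv

variable [DecidableEq V]

theorem IsNonseparable.isNonseparableIn {H : G.Subgraph} {B : Finset V} (hB : H.verts = B)
    (h : IsNonseparable H) : IsNonseparableIn G B := by
  obtain ⟨hc, hd⟩ := h
  obtain ⟨hp, hne⟩ := SimpleGraph.Subgraph.connected_iff.1 hc
  refine ⟨by rwa [hB, Finset.coe_nonempty] at hne, isPreconnectedIn_of_subgraph hB hp,
    fun v hv => isPreconnectedIn_of_subgraph (by simp [hB]) (hd v (by rw [hB]; exact hv))⟩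

theorem IsNonseparableIn.isNonseparable {H : G.Subgraph} {B : Finset V} (hB : H.verts = B)
    (hH : ∀ x ∈ B, ∀ y ∈ B, G.Adj x y → H.Adj x y) (h : IsNonseparableIn G B) :
    IsNonseparable H := by
  refine ⟨SimpleGraph.Subgraph.connected_iff.2 ⟨h.2.1.subgraph_preconnected hB hH, ?_⟩, ?_⟩
  · rw [hB, Finset.coe_nonempty]; exact h.1
  · intro v hv
    rw [hB] at hv
    refine (h.2.2 v hv).subgraph_preconnected (by simp [hB]) fun x hx y hy hxy => ?_
    obtain ⟨hxv, hx⟩ := Finset.mem_erase.1 hx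
    obtain ⟨hyv, hy⟩ := Finset.mem_erase.1 hy
    rw [SimpleGraph.Subgraph.deleteVerts_adj, hB]
    exact ⟨hx, hxv, hy, hyv, hH x hx y hy hxy⟩

/-! ### One-sums of cliques -/

/-- A vertex set in which `p` is adjacent to all other vertices, and is the only vertex which is not
simplicial, is a one-sum of cliques. -/
theorem isOneSumOfCliques_of_isSimplicialIn {C : Finset V} {p : V} (hp : p ∈ C)
    (hpC : ∀ x ∈ C, x ≠ p → G.Adj p x) (hs : ∀ x ∈ C, x ≠ p → IsSimplicialIn G C x)
    (hns : ¬ IsSimplicialIn G C p) : IsOneSumOfCliques G C := by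
  classical
  -- The cliques of the sum are the closed neighbourhoods in `C` of the vertices other than `p`; two
  -- of these sharing a vertex other than `p` coincide.
  set N : V → Finset V := fun x => C.filter fun y => y = x ∨ G.Adj x y with hN
  have hmem : ∀ {x y}, y ∈ N x ↔ y ∈ C ∧ (y = x ∨ G.Adj x y) := by simp [hN]
  have hpN : ∀ x ∈ C, x ≠ p → p ∈ N x := fun x hx hxp =>
    hmem.2 ⟨hp, .inr (hpC x hx hxp).symm⟩
  -- the closed neighbourhoods of `x` and of its neighbour `y` agree
  have hsub : ∀ x ∈ C, x ≠ p → ∀ y ∈ C, G.Adj x y → N x ⊆ N y := by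
    intro x hx hxp y hy hxy z hz
    obtain ⟨hzC, rfl | hxz⟩ := hmem.1 hz
    · exact hmem.2 ⟨hzC, .inr hxy.symm⟩
    · by_cases hyz : y = z
      · exact hmem.2 ⟨hzC, .inl hyz.symm⟩
      · exact hmem.2 ⟨hzC, .inr (hs x hx hxp y hy z hzC hxy hxz hyz)⟩
  have heq : ∀ x ∈ C, x ≠ p → ∀ y ∈ C, y ≠ p → y ∈ N x → N x = N y := by
    intro x hx hxp y hy hyp hyx
    rcases (hmem.1 hyx).2 with rfl | hxy
    · rfl
    · exact (hsub x hx hxp y hy hxy).antisymm (hsub y hy hyp x hx hxy.symm)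
  have hself : ∀ x ∈ C, x ∈ N x := fun x hx => hmem.2 ⟨hx, .inl rfl⟩
  refine ⟨p, (C.erase p).image N, ?_, ?_, ?_, ?_, ?_⟩
  · obtain ⟨a, ha, b, hb, hpa, hpb, hab, hnab⟩ : ∃ a ∈ C, ∃ b ∈ C, G.Adj p a ∧ G.Adj p b ∧ a ≠ b ∧
        ¬ G.Adj a b := by
      simpa only [IsSimplicialIn, not_forall, exists_prop] using hns
    refine Finset.one_lt_card.2 ⟨N a, Finset.mem_image_of_mem _ (Finset.mem_erase.2 ⟨hpa.ne', ha⟩),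
      N b, Finset.mem_image_of_mem _ (Finset.mem_erase.2 ⟨hpb.ne', hb⟩), fun h => ?_⟩
    have hba : b ∈ N a := h ▸ hself b hb
    rcases (hmem.1 hba).2 with h | h
    · exact hab h.symm
    · exact hnab h
  · intro A hA
    obtain ⟨x, hx, rfl⟩ := Finset.mem_image.1 hA
    obtain ⟨hxp, hx⟩ := Finset.mem_erase.1 hx
    refine ⟨hpN x hx hxp, Finset.one_lt_card.2 ⟨p, hpN x hx hxp, x, hself x hx, hxp.symm⟩, ?_⟩
    intro a ha b hb hab
    obtain ⟨ha, hax⟩ := hmem.1 ha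
    obtain ⟨hb, hbx⟩ := hmem.1 hb
    rcases hax with rfl | hax
    · exact hbx.resolve_left hab.symm
    rcases hbx with rfl | hbx
    · exact hax.symm
    · exact hs x hx hxp a ha b hb hax hbx hab
  · intro A hA B hB hAB
    obtain ⟨x, hx, rfl⟩ := Finset.mem_image.1 hA
    obtain ⟨hxp, hx⟩ := Finset.mem_erase.1 hx
    obtain ⟨y, hy, rfl⟩ := Finset.mem_image.1 hB
    obtain ⟨hyp, hy⟩ := Finset.mem_erase.1 hy
    refine Finset.eq_singleton_iff_unique_mem.2
      ⟨Finset.mem_inter.2 ⟨hpN x hx hxp, hpN y hy hyp⟩, fun z hz => ?_⟩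
    obtain ⟨hzx, hzy⟩ := Finset.mem_inter.1 hz
    by_contra hzp
    have hzC := (hmem.1 hzx).1
    exact hAB ((heq x hx hxp z hzC hzp hzx).trans (heq y hy hyp z hzC hzp hzy).symm)
  · ext z
    simp only [Finset.mem_biUnion, Finset.mem_image, id, Finset.mem_erase]
    constructor
    · intro hz
      by_cases hzp : z = p
      · subst hzp
        obtain ⟨a, ha, -, -, hpa, -⟩ : ∃ a ∈ C, ∃ b ∈ C, G.Adj z a ∧ G.Adj z b ∧ a ≠ b ∧
            ¬ G.Adj a b := by
          simpa only [IsSimplicialIn, not_forall, exists_prop] using hns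
        exact ⟨_, ⟨a, ⟨hpa.ne', ha⟩, rfl⟩, hpN a ha hpa.ne'⟩
      · exact ⟨_, ⟨z, ⟨hzp, hz⟩, rfl⟩, hself z hz⟩
    · rintro ⟨_, ⟨x, -, rfl⟩, hzx⟩
      exact (hmem.1 hzx).1
  · intro x hx y hy hxy
    by_cases hxp : x = p
    · subst hxp
      exact ⟨N y, Finset.mem_image_of_mem _ (Finset.mem_erase.2 ⟨hxy.ne', hy⟩),
        hpN y hy hxy.ne', hself y hy⟩
    · exact ⟨N x, Finset.mem_image_of_mem _ (Finset.mem_erase.2 ⟨hxp, hx⟩), hself x hx,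
        hmem.2 ⟨hy, .inr hxy⟩⟩

/-- A vertex other than the common one lies in a single clique together with all its neighbours in
`C`, whereas the common vertex has nonadjacent neighbours in two different cliques. -/
theorem IsOneSumOfCliques.exists_isSimplicialIn {C : Finset V} (h : IsOneSumOfCliques G C) :
    ∃ p ∈ C, (∀ x ∈ C, x ≠ p → IsSimplicialIn G C x) ∧ ¬ IsSimplicialIn G C p := by
  obtain ⟨v, K, hK, hcl, hinter, rfl, hedge⟩ := h
  have huniq : ∀ A ∈ K, ∀ B ∈ K, ∀ x ∈ A, x ∈ B → x ≠ v → A = B := by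
    intro A hA B hB x hxA hxB hxv
    by_contra hAB
    have hx : x ∈ A ∩ B := Finset.mem_inter.2 ⟨hxA, hxB⟩
    rw [hinter A hA B hB hAB, Finset.mem_singleton] at hx
    exact hxv hx
  obtain ⟨A, hA, B, hB, hAB⟩ := Finset.one_lt_card.1 hK
  have hmem : ∀ D ∈ K, ∀ x ∈ D, x ∈ K.biUnion id := fun D hD x hx =>
    Finset.mem_biUnion.2 ⟨D, hD, hx⟩
  refine ⟨v, hmem A hA v (hcl A hA).1, fun x hx hxv a ha b hb hxa hxb hab => ?_, fun h => ?_⟩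
  · obtain ⟨D, hD, hxD, haD⟩ := hedge x hx a ha hxa
    obtain ⟨E, hE, hxE, hbE⟩ := hedge x hx b hb hxb
    obtain rfl := huniq D hD E hE x hxD hxE hxv
    exact (hcl D hD).2.2 haD hbE hab
  · obtain ⟨a, haA, hav⟩ := Finset.exists_mem_ne (hcl A hA).2.1 v
    obtain ⟨b, hbB, hbv⟩ := Finset.exists_mem_ne (hcl B hB).2.1 v
    have hab : a ≠ b := by
      rintro rfl
      exact hAB (huniq A hA B hB a haA hbB hav)
    have hadj := h a (hmem A hA a haA) b (hmem B hB b hbB)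
      ((hcl A hA).2.2 (hcl A hA).1 haA hav.symm) ((hcl B hB).2.2 (hcl B hB).1 hbB hbv.symm) hab
    obtain ⟨D, hD, haD, hbD⟩ := hedge a (hmem A hA a haA) b (hmem B hB b hbB) hadj
    exact hAB ((huniq A hA D hD a haA haD hav).trans (huniq B hB D hD b hbB hbD hbv).symm)

variable [Fintype V]

/-- Extra edges on the same vertices preserve nonseparability, so a maximal nonseparable subgraph is
induced and determined by its vertex set. -/
theorem numBlocks_eq_numBlocksIn : numBlocks G = numBlocksIn G Finset.univ := by
  set I : Finset V → G.Subgraph := fun B => (⊤ : G.Subgraph).induce B with hI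
  have hIv : ∀ B, (I B).verts = B := fun B => rfl
  have hIa : ∀ B : Finset V, ∀ x ∈ B, ∀ y ∈ B, G.Adj x y → (I B).Adj x y := fun B x hx y hy hxy =>
    ⟨hx, hy, hxy⟩
  have hle : ∀ (H : G.Subgraph) (B : Finset V), H.verts ⊆ B → H ≤ I B := fun H B hB =>
    ⟨hB, fun x y hxy => ⟨hB hxy.fst_mem, hB hxy.snd_mem, hxy.adj_sub⟩⟩
  have hfin : ∀ H : G.Subgraph, ∃ B : Finset V, H.verts = B := fun H =>
    ⟨(Set.toFinite H.verts).toFinset, by simp⟩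
  have himage : {H : G.Subgraph | IsBlock H} = I '' {B | IsBlockIn G Finset.univ B} := by
    ext H
    constructor
    · intro hH
      obtain ⟨B, hB⟩ := hfin H
      have hBn := IsNonseparable.isNonseparableIn hB hH.1
      have hHI : H = I B :=
        hH.eq_of_le (hBn.isNonseparable (hIv B) (hIa B)) (hle H B hB.le)
      refine ⟨B, isBlockIn_iff.2 ⟨⟨Finset.subset_univ _, hBn⟩, fun D _ hD hBD => ?_⟩, hHI.symm⟩
      have hHD : H ≤ I D := hle H D (hB.le.trans (Finset.coe_subset.2 hBD))
      have := (hH.2 (hD.isNonseparable (hIv D) (hIa D)) hHD).1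
      rw [hB, hIv] at this
      exact Finset.coe_subset.1 this
    · rintro ⟨B, hB, rfl⟩
      refine ⟨hB.1.2.isNonseparable (hIv B) (hIa B), fun H hH hBH => ?_⟩
      obtain ⟨D, hD⟩ := hfin H
      have hBD : B ⊆ D := by
        have := hBH.1
        rw [hD, hIv] at this
        exact Finset.coe_subset.1 this
      rw [hB.eq (Finset.subset_univ D) (IsNonseparable.isNonseparableIn hD hH) hBD]
      exact hle H D hD.le
  rw [numBlocks, himage, numBlocksIn, Set.ncard_image_of_injective]
  intro B D hBD
  have := congrArg SimpleGraph.Subgraph.verts hBD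
  exact Finset.coe_injective this

/-! ### Convex sets and their interior -/

theorem isConvex_iff_shellsTo {C : Finset V} : IsConvex G C ↔ ShellsTo G Finset.univ C := by
  constructor
  · rintro ⟨l, hl, hC⟩
    induction l using List.reverseRecOn generalizing C with
    | nil =>
      have : C = Finset.univ := Finset.eq_univ_iff_forall.2 (by simpa using hC)
      exact this ▸ .refl
    | append_singleton l v ih =>
      obtain ⟨hl, hv⟩ := isShellable_append_singleton.1 hl
      have hmem : ∀ w, w ∈ Finset.univ.filter (fun w => w ∉ l) ↔ w ∉ {w | w ∈ l} := by simp
      obtain ⟨hvD, hvs⟩ := (isSimplicialAfter_iff hmem).1 hv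
      have hD := (ih (C := Finset.univ.filter fun w => w ∉ l) hl (by simp)).step hvD hvs
      convert hD using 1
      ext w
      have := hC w
      simp only [Finset.mem_compl, List.mem_append, List.mem_singleton] at this
      simp only [Finset.mem_erase, Finset.mem_filter, Finset.mem_univ, true_and]
      tauto
  · intro h
    induction h with
    | refl => exact ⟨[], fun i h => by simp at h, by simp⟩
    | @step C v _ hv hs ih =>
      obtain ⟨l, hl, hC⟩ := ih
      have hC' : ∀ w, w ∈ C ↔ w ∉ {w | w ∈ l} := fun w => by
        rw [Set.mem_ofPred_eq, ← hC w, Finset.mem_compl, not_not]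
      refine ⟨l ++ [v], isShellable_append_singleton.2
        ⟨hl, (isSimplicialAfter_iff hC').2 ⟨hv, hs⟩⟩, fun w => ?_⟩
      have := hC w
      simp only [Finset.mem_compl] at this
      simp only [Finset.mem_compl, Finset.mem_erase, List.mem_append, List.mem_singleton]
      tauto

/-- If a convex set containing `C \ p` misses `p`, then `p` was shelled off and is simplicial over
what remained. Conversely, if `p` is simplicial then `C \ p` is itself convex. -/
theorem notMem_convexClosure_erase_iff {C : Finset V} (hC : IsConvex G C) {p : V} (hp : p ∈ C) :
    p ∉ convexClosure G (C.erase p) ↔ IsSimplicialIn G C p := by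
  simp only [convexClosure, Finset.mem_filter, Finset.mem_univ, true_and, not_forall]
  constructor
  · rintro ⟨D, hD, hCD, hpD⟩ a ha b hb hpa hpb
    exact (isConvex_iff_shellsTo.1 hD).isSimplicialIn_of_notMem (Finset.mem_univ p) hpD
      a (hCD (Finset.mem_erase.2 ⟨hpa.ne', ha⟩)) b (hCD (Finset.mem_erase.2 ⟨hpb.ne', hb⟩)) hpa hpb
  · intro h
    exact ⟨C.erase p, isConvex_iff_shellsTo.2 ((isConvex_iff_shellsTo.1 hC).step hp h),
      subset_rfl, by simp⟩

theorem mem_interiorPoints_iff {C : Finset V} (hC : IsConvex G C) {p : V} :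
    p ∈ interiorPoints G C ↔ p ∈ C ∧ ¬ IsSimplicialIn G C p := by
  simp only [interiorPoints, extremePoints, Finset.mem_sdiff, Finset.mem_filter, not_and]
  refine and_congr_right fun hp => ?_
  rw [← notMem_convexClosure_erase_iff hC hp]
  simp [hp]

theorem mem_oneInteriorConvexSets_iff {C : Finset V} :
    C ∈ oneInteriorConvexSets G ↔ HasOneInterior G Finset.univ C := by
  simp only [oneInteriorConvexSets, Finset.mem_filter, Finset.mem_univ, true_and,
    Finset.card_eq_one, Finset.eq_singleton_iff_unique_mem]
  constructor
  · rintro ⟨hC, p, hp, huniq⟩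
    obtain ⟨hpC, hps⟩ := (mem_interiorPoints_iff hC).1 hp
    refine ⟨p, ⟨isConvex_iff_shellsTo.1 hC, hpC, fun x hx hxp => ?_⟩, hps⟩
    by_contra h
    exact hxp (huniq x ((mem_interiorPoints_iff hC).2 ⟨hx, h⟩))
  · rintro ⟨p, ⟨hC, hpC, hs⟩, hp⟩
    have hC := isConvex_iff_shellsTo.2 hC
    refine ⟨hC, p, (mem_interiorPoints_iff hC).2 ⟨hpC, hp⟩, fun x hx => ?_⟩
    obtain ⟨hxC, hxs⟩ := (mem_interiorPoints_iff hC).1 hx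
    exact by_contra fun h => hxs (hs x hxC h)

end ChordalShelling

theorem mainTheorem7 {V : Type*} [Fintype V] [DecidableEq V] (G : SimpleGraph V)
    (hconn : G.Connected) (hchordal : ChordalShelling.IsChordal G) :
    (∀ C : Finset V, C ∈ ChordalShelling.oneInteriorConvexSets G ↔
      ChordalShelling.IsConvex G C ∧ ChordalShelling.IsOneSumOfCliques G C) ∧
    ∑ S ∈ ChordalShelling.oneInteriorConvexSets G, (-1 : ℤ) ^ S.card =
      1 - (ChordalShelling.numBlocks G : ℤ) := by
  have hpre := ChordalShelling.isPreconnectedIn_univ hconn.preconnected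
  have := hconn.nonempty
  refine ⟨fun C => ?_, ?_⟩
  · rw [ChordalShelling.mem_oneInteriorConvexSets_iff, ChordalShelling.isConvex_iff_shellsTo]
    constructor
    · rintro ⟨p, ⟨hC, hp, hs⟩, hns⟩
      exact ⟨hC, ChordalShelling.isOneSumOfCliques_of_isSimplicialIn hp
        (fun x hx hxp => (hC.isPreconnectedIn hpre).adj_of_forall_isSimplicialIn hp hs hx hxp)
        hs hns⟩
    · rintro ⟨hC, hsum⟩
      obtain ⟨p, hp, hs, hns⟩ := hsum.exists_isSimplicialIn
      exact ⟨p, ⟨hC, hp, hs⟩, hns⟩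
  · classical
    rw [ChordalShelling.numBlocks_eq_numBlocksIn,
      ← ChordalShelling.oneInteriorSum_eq hchordal.hasSimplicialVertices Finset.univ
        Finset.univ_nonempty hpre, ChordalShelling.oneInteriorSum]
    refine Finset.sum_congr (Finset.ext fun C => ?_) fun _ _ => rfl
    simp [ChordalShelling.mem_oneInteriorConvexSets_iff]
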